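/- Let $k$ be a number field with a fixed algebraic closure $\bar k$, let $X$ be a smooth, proper, geometrically integral variety over $k$, let $G$ be a linear algebraic group over $k$ (an affine $k$-group scheme of finite type), let $f\colon Y\to X$ be a $G$-torsor with $Y$ a smooth $k$-variety (separated and of finite type over $k$), and let $d\in\mathbb Z$. For a field $F$ and an $F$-scheme $V$ of finite type, let $Z_0^d(V)$ be the set of $0$-cycles of degree $d$ on $V$, i.e. of formal finite sums $\sum_x n_x x$ with $n_x\in\mathbb Z$ and $x$ a closed point of $V$, such that $\sum_x n_x[F(x):F]=d$, where $F(x)$ is the residue field of $x$. The pushforward of a $0$-cycle along a morphism $g$ is $g_*\big(\sum_y n_y y\big)=\sum_y n_y[\kappa(y):\kappa(g(y))]\,g(y)$, where $\kappa$ denotes residue fields. For a finite extension $K$ of $k$ in $\bar k$, let $H^1(K,G)$ be the set of isomorphism classes of $G_K$-torsors over $\operatorname{Spec}K$. For $\tau\in H^1(K,G)$, the class of a torsor $P$, let $f_K^\tau\colon Y_K^\tau\to X_K$ be the twist of $f_K\colon Y_K\to X_K$ by $\tau$, i.e. $Y_K^\tau$ is the quotient of $Y_K\times_K P$ by the diagonal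 action of $G_K$; it is unique up to isomorphism over $X_K$. Let $s_K\colon X_K\to X$ be the projection. The degree $d$ global descent set $Z_0^d(X)^f$ of $X$ associated to $f$ is the set of all formal sums $$\sum_{K\in S}\ \sum_{\tau\in T_K}(s_K\circ f_K^\tau)_*(z_{K,\tau}),$$ where $S$ is a non-empty finite set of finite extensions of $k$ contained in $\bar k$, $T_K\subset H^1(K,G)$ is a non-empty finite subset for each $K\in S$, the $\Delta_{K,\tau}$ (for $K\in S$, $\tau\in T_K$) are integers with $\sum_{K\in S}[K:k]\sum_{\tau\in T_K}\Delta_{K,\tau}=d$, and $z_{K,\tau}\in Z_0^{\Delta_{K,\tau}}(Y_K^\tau)$. Then $Z_0^d(X)^f=Z_0^d(X)$. -/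

import Mathlib

open CategoryTheory AlgebraicGeometry MonoidalCategory CartesianMonoidalCategory

universe u

namespace ZeroCycleDescent

section DiagonalAction

open scoped MonObj

universe v w

variable {C : Type w} [Category.{v} C] [CartesianMonoidalCategory C]

/-- The diagonal action of a group object `G` on a product `Y × P` of two objects with
`G`-action: `g • (y, p) = (g • y, g • p)`. -/
abbrev diagonalAction (G Y P : C) [MonObj G] [ModObj G Y] [ModObj G P] :
    ModObj G (Y ⊗ P) where
  smul := lift (G ◁ fst Y P ≫ γ[G, Y]) (G ◁ snd Y P ≫ γ[G, P])
  one_smul := by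
    change η[G] ▷ (Y ⊗ P) ≫ lift (G ◁ fst Y P ≫ γ[G, Y]) (G ◁ snd Y P ≫ γ[G, P]) =
      (λ_ (Y ⊗ P)).hom
    apply CartesianMonoidalCategory.hom_ext
    · have h := whisker_exchange (η[G]) (fst Y P)
      rw [Category.assoc, lift_fst, ← reassoc_of% h, ModObj.one_smul_self,
        leftUnitor_naturality]
    · have h := whisker_exchange (η[G]) (snd Y P)
      rw [Category.assoc, lift_snd, ← reassoc_of% h, ModObj.one_smul_self,
        leftUnitor_naturality]
  mul_smul := by
    change μ[G] ▷ (Y ⊗ P) ≫ lift (G ◁ fst Y P ≫ γ[G, Y]) (G ◁ snd Y P ≫ γ[G, P]) =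
      (α_ G G (Y ⊗ P)).hom ≫
        G ◁ lift (G ◁ fst Y P ≫ γ[G, Y]) (G ◁ snd Y P ≫ γ[G, P]) ≫
        lift (G ◁ fst Y P ≫ γ[G, Y]) (G ◁ snd Y P ≫ γ[G, P])
    apply CartesianMonoidalCategory.hom_ext
    · have h := whisker_exchange (μ[G]) (fst Y P)
      simp only [Category.assoc, lift_fst]
      rw [← reassoc_of% h, ModObj.mul_smul_self, ← MonoidalCategory.whiskerLeft_comp_assoc,
        lift_fst]
      simp
    · have h := whisker_exchange (μ[G]) (snd Y P)
      simp only [Category.assoc, lift_snd]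
      rw [← reassoc_of% h, ModObj.mul_smul_self, ← MonoidalCategory.whiskerLeft_comp_assoc,
        lift_snd]
      simp

end DiagonalAction

section Torsors

open scoped MonObj

variable {B : Scheme.{u}}

/-- Let `G` be a group scheme over `B` acting (on the left) on a `B`-scheme `Y`. A morphism of
`B`-schemes `p : Y ⟶ X` is a `G`-torsor if it is an fppf covering (flat, surjective, locally of
finite presentation), is invariant under `G`, and the morphism
`G ×_B Y ⟶ Y ×_X Y`, `(g, y) ↦ (y, g • y)`, is an isomorphism. The last two conditions are
expressed together, by saying that the square formed by `(g, y) ↦ y`, `(g, y) ↦ g • y`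
and twice `p` is cartesian. -/
structure IsTorsor (G : Over B) [GrpObj G] {Y X : Over B} [ModObj G Y] (p : Y ⟶ X) : Prop where
  flat : Flat p.left
  surjective : Surjective p.left
  locallyOfFinitePresentation : LocallyOfFinitePresentation p.left
  isPullback : IsPullback (snd G Y) γ[G, Y] p p

/-- A `G`-torsor `Y ⟶ X` over the `B`-scheme `X`. -/
structure Torsor (G : Over B) [GrpObj G] (X : Over B) where
  /-- The total space `Y`. -/
  total : Over B
  /-- The action of `G` on `Y`. -/
  [action : ModObj G total]
  /-- The morphism `Y ⟶ X`. -/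
  proj : total ⟶ X
  isTorsor : IsTorsor G proj

attribute [instance] Torsor.action

/-- Two `G`-torsors over `X` are isomorphic if there is a `G`-equivariant isomorphism over `X`
between their total spaces. -/
def Torsor.Isomorphic {G : Over B} [GrpObj G] {X : Over B} (P Q : Torsor G X) : Prop :=
  ∃ e : P.total ≅ Q.total, e.hom ≫ Q.proj = P.proj ∧ γ[G, P.total] ≫ e.hom = G ◁ e.hom ≫ γ[G, Q.total]

/-- Isomorphism of `G`-torsors over `X`, as an equivalence relation. -/
def torsorSetoid (G : Over B) [GrpObj G] (X : Over B) : Setoid (Torsor G X) where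
  r := Torsor.Isomorphic
  iseqv :=
    { refl := fun P => ⟨Iso.refl _, by simp, by simp⟩
      symm := by
        rintro P Q ⟨e, h₁, h₂⟩
        refine ⟨e.symm, by simp [← h₁], ?_⟩
        rw [← cancel_mono e.hom]
        simp [h₂, ← MonoidalCategory.whiskerLeft_comp_assoc]
      trans := by
        rintro P Q R ⟨e, h₁, h₂⟩ ⟨e', h₁', h₂'⟩
        refine ⟨e ≪≫ e', by simp [h₁, h₁'], ?_⟩
        simp [reassoc_of% h₂, h₂'] }

/-- The set `H¹(X, G)` of isomorphism classes of `G`-torsors over the `B`-scheme `X`. -/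
def H1 (X G : Over B) [GrpObj G] : Type (u + 1) :=
  Quotient (torsorSetoid G X)

/-- The class in `H¹(X, G)` of a `G`-torsor over `X`. -/
def Torsor.cls {G : Over B} [GrpObj G] {X : Over B} (P : Torsor G X) : H1 X G :=
  Quotient.mk (torsorSetoid G X) P

/-- Let `f : Y ⟶ X` be a `G`-torsor, let `L` be a `B`-scheme and let `τ ∈ H¹(L, G)`.
A twist of `f` by `τ` is a scheme `Y_L^τ` over `X_L = X ×_B L` that is the contracted product of
`Y_L` with a torsor `P ⟶ L` of class `τ`: the quotient of `Y_L ×_L P = Y ×_B P` by the diagonal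
action of `G`, in the sense that `Y ×_B P ⟶ Y_L^τ` is a `G`-torsor for that action. For `G` affine
a twist exists, and it is unique up to isomorphism over `X_L`.

The morphism `Y_L^τ ⟶ X_L` is given by its two components, namely `toX`, which is the composite
`Y_L^τ ⟶ X_L ⟶ X`, and the structure morphism `toL : Y_L^τ ⟶ L`. -/
structure Twist {G X : Over B} [GrpObj G] (f : Torsor G X) (L : Over B) (τ : H1 L G) where
  /-- A torsor that represents `τ`. -/
  P : Torsor G L
  cls_eq : P.cls = τ
  /-- The twist `Y_L^τ`, seen as a scheme over `B`. -/
  total : Over B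
  /-- The quotient morphism. -/
  quot : f.total ⊗ P.total ⟶ total
  isTorsor : letI := diagonalAction G f.total P.total; IsTorsor G quot
  /-- The composite `Y_L^τ ⟶ X_L ⟶ X`. -/
  toX : total ⟶ X
  quot_toX : quot ≫ toX = fst f.total P.total ≫ f.proj
  /-- The structure morphism `Y_L^τ ⟶ L`. -/
  toL : total ⟶ L
  quot_toL : quot ≫ toL = snd f.total P.total ≫ P.proj

end Torsors

section ZeroCycles

/-- The degree `∑ n_x [F(x) : F]` of the formal sum of points `∑ n_x x` on a scheme `V` with
structure morphism `π : V ⟶ Spec F`, where `F` is a field (`π.residueDegree x` is the degree of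
the extension of the residue field at `x` over that at `π x`, which is `F`). -/
noncomputable def degree {V T : Scheme.{u}} (π : V ⟶ T) (z : V →₀ ℤ) : ℤ :=
  z.sum fun x n => n * (π.residueDegree x : ℤ)

/-- The set `Z_0^d(V)` of `0`-cycles of degree `d` on a scheme `V` with structure morphism
`π : V ⟶ Spec F`: formal `ℤ`-linear combinations of closed points, of degree `d`. -/
def zeroCyclesOfDegree {V T : Scheme.{u}} (π : V ⟶ T) (d : ℤ) : Set (V →₀ ℤ) :=
  {z | (z.support : Set V) ⊆ closedPoints V ∧ degree π z = d}

/-- The pushforward `∑ n_y [k(y) : k(g(y))] g(y)` of `∑ n_y y` along `g`. -/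
noncomputable def pushforward {V W : Scheme.{u}} (g : V ⟶ W) (z : V →₀ ℤ) : W →₀ ℤ :=
  z.sum fun y n => Finsupp.single (g y) (n * (g.residueDegree y : ℤ))

end ZeroCycles

section Descent

variable (k kbar : Type u) [Field k] [Field kbar] [Algebra k kbar]

/-- The set of finite extensions of `k` contained in `kbar`. -/
abbrev FiniteSubextension : Type u :=
  {K : IntermediateField k kbar // FiniteDimensional k K}

variable {k kbar}

/-- `Spec K` as a scheme over `Spec k`. -/
noncomputable abbrev specOver (K : FiniteSubextension k kbar) : Over (Spec (.of k)) :=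
  Over.mk (Spec.map (CommRingCat.ofHom (algebraMap k K.1)))

/-- A pair consisting of a non-empty finite set `S` of finite extensions of `k` in `kbar` and a
family of non-empty finite sets `T_K ⊆ H¹(K, G)`, for `K ∈ S`. -/
structure DescentIndex (kbar : Type u) [Field kbar] [Algebra k kbar]
    (G : Over (Spec (.of k))) [GrpObj G] where
  /-- The finite set of extensions. -/
  S : Finset (FiniteSubextension k kbar)
  S_nonempty : S.Nonempty
  /-- The finite sets of classes. -/
  T : ∀ K : S, Finset (H1 (specOver K.1) G)
  T_nonempty : ∀ K, (T K).Nonempty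

variable {G X : Over (Spec (.of k))} [GrpObj G]

/-- The map `𝐟_*`: it sends a family of cycles `z_{K,τ}` on the twists `Y_K^τ`, for `K ∈ S` and
`τ ∈ T_K`, to the sum of their pushforwards along `Y_K^τ ⟶ X_K ⟶ X`. -/
noncomputable def descentPushforward (f : Torsor G X) (I : DescentIndex kbar G)
    (Yt : ∀ (K : I.S) (τ : I.T K), Twist f (specOver K.1) τ.1)
    (z : ∀ (K : I.S) (τ : I.T K), (Yt K τ).total.left →₀ ℤ) : X.left →₀ ℤ :=
  ∑ K : I.S, ∑ τ : I.T K, pushforward (Yt K τ).toX.left (z K τ)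

/-- The degree `d` global descent set `Z_0^d(X)^f` of `X` associated to `f`: the union, over all
`S`, all families `(T_K)` and all families of integers `Δ_{K,τ}` with
`∑_K [K : k] ∑_τ Δ_{K,τ} = d`, of the image under `𝐟_*` of `∏_K ∏_τ Z_0^{Δ_{K,τ}}(Y_K^τ)`.
(The image does not depend on the choice of the twists `Y_K^τ`, which are unique up to
isomorphism.) -/
def descentSet (kbar : Type u) [Field kbar] [Algebra k kbar] (f : Torsor G X) (d : ℤ) :
    Set (X.left →₀ ℤ) :=
  {x | ∃ (I : DescentIndex kbar G)
      (Yt : ∀ (K : I.S) (τ : I.T K), Twist f (specOver K.1) τ.1)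
      (Δ : ∀ K : I.S, I.T K → ℤ)
      (z : ∀ (K : I.S) (τ : I.T K), (Yt K τ).total.left →₀ ℤ),
      ∑ K : I.S, (Module.finrank k K.1.1 : ℤ) * ∑ τ : I.T K, Δ K τ = d ∧
      (∀ K τ, z K τ ∈ zeroCyclesOfDegree (Yt K τ).toL.left (Δ K τ)) ∧
      descentPushforward f I Yt z = x}

end Descent

end ZeroCycleDescent

/-!
The easy inclusion `Z_0^d(X)^f ⊆ Z_0^d(X)` counts degrees: residue degrees are multiplicative, so a
cycle of degree `Δ` on a twist over `K` pushes forward to one of degree `[K : k] Δ`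
(`Twist.pushforward_mem`).

For the other inclusion, let `x` be a closed point of `X`, with residue field embedded into `kbar` as
a finite extension `K` of `k`, so that `x` is the image of some `i : Spec K ⟶ X`. Let `τ` be the class
of the pullback `P` of the torsor `Y ⟶ X` along `i`. The morphism `P ⟶ Y × P` with components the
projection and the identity is equivariant, and descends to a `K`-rational point of the twist `Y^τ`
lying over `x` (`Twist.exists_section`); its pushforward is exactly `x`. Hence a cycle `∑ n_x x` is
the sum of the pushforwards of the `n_x`-multiples of such points, sorted by the pair `(K, τ)`
(`zeroCyclesOfDegree_subset`).

The substance is the existence of the twist (`exists_twist`), that is, of the quotient of `Y × P` by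
the diagonal action. As `G` is affine, so are torsors under `G`, because affineness descends along
fpqc coverings (`isAffineHom_of_isPullback_of_flat`). Thus `Y × P` is affine over `W = X × Spec K`, and
the quotient is the relative spectrum over `W` of the algebra of invariant functions
(`exists_affine_coequalizer`). The equivariant projection `Y × P ⟶ P` trivializes the action after
base change along `P ⟶ Spec K`, and flatness of that morphism shows that `Y × P` is the base change of
the quotient (`Algebra.bijective_productMap_equalizer_of_descentDatum`,
`exists_isPullback_of_descentDatum`, `IsTorsor.exists_quotient`). The twist is affine over `W`, so it
is separated over `K` and its rational points are closed.
-/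

/-! ### Descent of algebras along a torsor -/

open TensorProduct in

/-- Descent along a torsor, in terms of rings. Think of `C` as functions on a torsor, of `M` as
functions on a space `T'` with an equivariant map to that torsor (which gives `c`), and of `R` and
`R₂` as functions on `G × T'` and `G × G × T'`: `a` and `p` are the action and the projection, `e` is
the unit section, `p₂` is the projection forgetting the first factor, and `α`, `β` are
`(g', g, y) ↦ (g', g y)` and `(g', g, y) ↦ (g' g, y)`. The conclusion is that `M` is obtained by base
change to `C` from the ring of invariants, that is, the equalizer of `a` and `p`. -/
theorem Algebra.bijective_productMap_equalizer_of_descentDatum {A C M R R₂ : Type*}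
    [CommRing A] [CommRing C] [CommRing M] [CommRing R] [CommRing R₂]
    [Algebra A C] [Algebra A M] [Algebra A R] [Algebra A R₂] [Module.Flat A C]
    (c : C →ₐ[A] M) (a p : M →ₐ[A] R) (j : C →ₐ[A] R) (e : R →ₐ[A] M)
    (p₂ : R →ₐ[A] R₂) (j₂ : C →ₐ[A] R₂) (α β : R →ₐ[A] R₂)
    (hR : Function.Bijective (Algebra.TensorProduct.productMap p j))
    (hR₂ : Function.Bijective (Algebra.TensorProduct.productMap p₂ j₂))
    (hac : a.comp c = j) (hea : e.comp a = AlgHom.id A M)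
    (hαp : α.comp p = p₂.comp a) (hαj : α.comp j = j₂)
    (hβp : β.comp p = p₂.comp p) (hβj : β.comp j = j₂) (h : α.comp a = β.comp a) :
    Function.Bijective (Algebra.TensorProduct.productMap (AlgHom.equalizer a p).val c) := by
  set D := AlgHom.equalizer a p
  let ι : D ⊗[A] C →ₐ[A] M ⊗[A] C := Algebra.TensorProduct.map D.val (AlgHom.id A C)
  have hι : Function.Injective ι :=
    Module.Flat.rTensor_preserves_injective_linearMap D.val.toLinearMap Subtype.val_injective
  have ha : a.comp (Algebra.TensorProduct.productMap D.val c) =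
      (Algebra.TensorProduct.productMap p j).comp ι := by
    ext x
    · have hx : a x = p x := x.2
      simpa [ι] using hx
    · simp [ι, ← hac]
  refine ⟨?_, fun m ↦ ?_⟩
  -- composing the comparison map with `a` turns it into the injection `D ⊗ C ⟶ M ⊗ C ≃ R`
  · refine Function.Injective.of_comp (f := a) ?_
    have : (a ∘ Algebra.TensorProduct.productMap D.val c : D ⊗[A] C → R) =
      Algebra.TensorProduct.productMap p j ∘ ι := congrArg DFunLike.coe ha
    rw [this]
    exact hR.1.comp hι
  -- `a m` comes from some `y ∈ M ⊗ C`, and the cocycle condition puts `y` in `D ⊗ C`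
  · obtain ⟨y, hy⟩ := hR.2 (a m)
    have hα : α.comp (Algebra.TensorProduct.productMap p j) =
        (Algebra.TensorProduct.productMap p₂ j₂).comp
          (Algebra.TensorProduct.map a (AlgHom.id A C)) := by
      ext x
      · simpa using DFunLike.congr_fun hαp x
      · simpa using DFunLike.congr_fun hαj x
    have hβ : β.comp (Algebra.TensorProduct.productMap p j) =
        (Algebra.TensorProduct.productMap p₂ j₂).comp
          (Algebra.TensorProduct.map p (AlgHom.id A C)) := by
      ext x
      · simpa using DFunLike.congr_fun hβp x
      · simpa using DFunLike.congr_fun hβj x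
    have hy' : Algebra.TensorProduct.map a (AlgHom.id A C) y =
        Algebra.TensorProduct.map p (AlgHom.id A C) y := by
      apply hR₂.1
      have h₁ := DFunLike.congr_fun hα y
      have h₂ := DFunLike.congr_fun hβ y
      have h₃ := DFunLike.congr_fun h m
      simp only [AlgHom.comp_apply] at h₁ h₂ h₃
      rw [← h₁, ← h₂, hy, h₃]
    -- flatness of `C` turns the equation `hy'` into membership in `D ⊗ C`
    have hex : Function.Exact (D.val.toLinearMap.rTensor C)
        ((a.toLinearMap - p.toLinearMap).rTensor C) := by
      apply Module.Flat.rTensor_exact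
      intro x
      simp only [LinearMap.sub_apply, sub_eq_zero]
      exact ⟨fun hx ↦ ⟨⟨x, hx⟩, rfl⟩, by rintro ⟨x, rfl⟩; exact x.2⟩
    obtain ⟨z, rfl⟩ := (hex y).mp (by
      rw [LinearMap.rTensor_sub, LinearMap.sub_apply, sub_eq_zero]
      exact hy')
    refine ⟨z, ?_⟩
    have h₁ := DFunLike.congr_fun ha z
    have h₂ : a (Algebra.TensorProduct.productMap D.val c z) = a m := by
      rw [← hy]; exact h₁
    simpa using (DFunLike.congr_fun hea _).symm.trans
      ((congrArg e h₂).trans (DFunLike.congr_fun hea m))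

/-- The formation of the equalizer of two ring homomorphisms commutes with localization at an
element of the equalizer. -/
theorem RingHom.isLocalizationAway_eqLocus {M R M' R' : Type*} [CommRing M] [CommRing R]
    [CommRing M'] [CommRing R'] [Algebra M M'] [Algebra R R'] (a p : M →+* R) (a' p' : M' →+* R')
    (ha : ∀ m, a' (algebraMap M M' m) = algebraMap R R' (a m))
    (hp : ∀ m, p' (algebraMap M M' m) = algebraMap R R' (p m))
    [Algebra (a.eqLocus p) (a'.eqLocus p')]
    (halg : ∀ m : a.eqLocus p, (algebraMap _ (a'.eqLocus p') m : M') = algebraMap M M' m)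
    (r : a.eqLocus p) [IsLocalization.Away (r : M) M'] [IsLocalization.Away (p r) R'] :
    IsLocalization.Away r (a'.eqLocus p') := by
  -- the inverse `s` of `r` in `M'` lies in the equalizer, since its two images are both inverse to
  -- the image of `r`
  obtain ⟨s, hs⟩ := isUnit_iff_exists_inv.mp
    (IsLocalization.Away.algebraMap_isUnit (S := M') (r : M))
  have hs' : a' s = p' s := by
    have h₁ := congrArg a' hs
    have h₂ := congrArg p' hs
    rw [map_mul, map_one, ha, show a r = p r from r.2] at h₁
    rw [map_mul, map_one, hp] at h₂
    have hu : IsUnit (algebraMap R R' (p r)) := IsLocalization.Away.algebraMap_isUnit _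
    exact hu.mul_left_cancel (h₁.trans h₂.symm)
  refine IsLocalization.Away.mk r ?_ (fun x ↦ ?_) (fun x y hxy ↦ ?_)
  · exact IsUnit.of_mul_eq_one ⟨s, hs'⟩ (Subtype.ext (by simpa [halg] using hs))
  · obtain ⟨n, m, hm⟩ := IsLocalization.Away.surj (r : M) (x : M')
    have hrx : algebraMap R R' (a m) = algebraMap R R' (p m) := by
      rw [← ha, ← hp, ← hm, map_mul, map_mul, map_pow, map_pow, ha, hp,
        show a r = p r from r.2, show a' x = p' x from x.2]
    obtain ⟨N, hN⟩ := IsLocalization.Away.exists_of_eq (p r : R) hrx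
    refine ⟨N + n, ⟨r ^ N * m, ?_⟩, Subtype.ext ?_⟩
    · change a (r ^ N * m) = p (r ^ N * m)
      rw [map_mul, map_mul, map_pow, map_pow, show a r = p r from r.2, hN]
    · rw [halg]
      simp [halg, ← hm]
      ring
  · obtain ⟨n, hn⟩ := IsLocalization.Away.exists_of_eq (S := M') (r : M) (a := x) (b := y)
      (by rw [← halg, ← halg, hxy])
    exact ⟨n, Subtype.ext (by simpa using hn)⟩

theorem CategoryTheory.IsPushout.iff_isIso {C : Type*} [Category* C] {A B D P P' : C} {f : A ⟶ B}
    {g : A ⟶ D} {i : B ⟶ P} {j : D ⟶ P} {i' : B ⟶ P'} {j' : D ⟶ P'} (H : IsPushout f g i j)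
    {k : P ⟶ P'} (hi : i ≫ k = i') (hj : j ≫ k = j') : IsPushout f g i' j' ↔ IsIso k := by
  refine ⟨fun H' ↦ ?_, fun _ ↦ ?_⟩
  · have : k = (H.isoIsPushout _ _ H').hom := H.hom_ext (by simp [hi]) (by simp [hj])
    rw [this]
    infer_instance
  · exact .of_iso H (.refl _) (.refl _) (.refl _) (asIso k) (by simp) (by simp) (by simpa)
      (by simpa)

theorem CommRingCat.isPushout_iff_bijective_productMap {R A B S : Type u} [CommRing R] [CommRing A]
    [CommRing B] [CommRing S] [Algebra R A] [Algebra R B] [Algebra R S]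
    (f : A →ₐ[R] S) (g : B →ₐ[R] S) :
    IsPushout (CommRingCat.ofHom (algebraMap R A)) (CommRingCat.ofHom (algebraMap R B))
      (CommRingCat.ofHom f.toRingHom) (CommRingCat.ofHom g.toRingHom) ↔
      Function.Bijective (Algebra.TensorProduct.productMap f g) := by
  have H := CommRingCat.isPushout_tensorProduct R A B
  have hf : CommRingCat.ofHom Algebra.TensorProduct.includeLeftRingHom ≫
      CommRingCat.ofHom (Algebra.TensorProduct.productMap f g).toRingHom =
        CommRingCat.ofHom f.toRingHom := by
    ext x
    simp
  have hg : CommRingCat.ofHom Algebra.TensorProduct.includeRight.toRingHom ≫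
      CommRingCat.ofHom (Algebra.TensorProduct.productMap f g).toRingHom =
        CommRingCat.ofHom g.toRingHom := by
    ext x
    simp
  rw [H.iff_isIso hf hg]
  exact ConcreteCategory.isIso_iff_bijective
    (CommRingCat.ofHom (Algebra.TensorProduct.productMap f g).toRingHom)

/-- `Algebra.bijective_productMap_equalizer_of_descentDatum` in terms of pushout squares, with a ring
`D` that is identified with the equalizer by `i`. -/
theorem CommRingCat.isPushout_of_descentDatum {A C M R R₂ D : CommRingCat.{u}}
    {s : A ⟶ C} (hs : s.hom.Flat) {m : A ⟶ M} {d : A ⟶ D} {i : D ⟶ M} {c : C ⟶ M}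
    {a p : M ⟶ R} {j : C ⟶ R} {e : R ⟶ M} {p₂ : R ⟶ R₂} {j₂ : C ⟶ R₂} {α β : R ⟶ R₂}
    (hdi : d ≫ i = m) (hsc : s ≫ c = m) (hma : m ≫ a = m ≫ p)
    (hinj : Function.Injective i) (hia : i ≫ a = i ≫ p) (hi : ∀ x, a x = p x → ∃ y, i y = x)
    (hR : IsPushout m s p j) (hR₂ : IsPushout (m ≫ p) s p₂ j₂)
    (hac : c ≫ a = j) (hea : a ≫ e = 𝟙 M) (hαp : p ≫ α = a ≫ p₂) (hαj : j ≫ α = j₂)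
    (hβp : p ≫ β = p ≫ p₂) (hβj : j ≫ β = j₂) (h : a ≫ α = a ≫ β) :
    IsPushout d s i c := by
  let := s.hom.toAlgebra
  let := m.hom.toAlgebra
  let := d.hom.toAlgebra
  let := (m ≫ p).hom.toAlgebra
  let := (m ≫ p ≫ p₂).hom.toAlgebra
  have : Module.Flat A C := hs
  let c' : C →ₐ[A] M := { c.hom with commutes' x := congr($hsc x) }
  let i' : D →ₐ[A] M := { i.hom with commutes' x := congr($hdi x) }
  let a' : M →ₐ[A] R := { a.hom with commutes' x := congr($hma x) }
  let p' : M →ₐ[A] R := { p.hom with commutes' x := rfl }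
  let j' : C →ₐ[A] R := { j.hom with commutes' x := congr($hR.w x).symm }
  have he : m ≫ p ≫ e = m := by rw [← reassoc_of% hma, hea, Category.comp_id]
  let e' : R →ₐ[A] M := { e.hom with commutes' x := congr($he x) }
  let p₂' : R →ₐ[A] R₂ := { p₂.hom with commutes' x := rfl }
  have hj₂ : s ≫ j₂ = m ≫ p ≫ p₂ := by rw [← hR₂.w, Category.assoc]
  let j₂' : C →ₐ[A] R₂ := { j₂.hom with commutes' x := congr($hj₂ x) }
  have hα : m ≫ p ≫ α = m ≫ p ≫ p₂ := by rw [hαp, reassoc_of% hma]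
  have hβ : m ≫ p ≫ β = m ≫ p ≫ p₂ := by rw [hβp]
  let α' : R →ₐ[A] R₂ := { α.hom with commutes' x := congr($hα x) }
  let β' : R →ₐ[A] R₂ := { β.hom with commutes' x := congr($hβ x) }
  have key := Algebra.bijective_productMap_equalizer_of_descentDatum c' a' p' j' e' p₂' j₂' α' β'
    ((isPushout_iff_bijective_productMap p' j').mp hR)
    ((isPushout_iff_bijective_productMap p₂' j₂').mp hR₂)
    (AlgHom.ext fun x ↦ congr($hac x)) (AlgHom.ext fun x ↦ congr($hea x))
    (AlgHom.ext fun x ↦ congr($hαp x)) (AlgHom.ext fun x ↦ congr($hαj x))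
    (AlgHom.ext fun x ↦ congr($hβp x)) (AlgHom.ext fun x ↦ congr($hβj x))
    (AlgHom.ext fun x ↦ congr($h x))
  refine (isPushout_iff_bijective_productMap i' c').mpr ?_
  let ε : D →ₐ[A] AlgHom.equalizer a' p' := i'.codRestrict _ fun x ↦ congr($hia x)
  have hε : Function.Bijective ε :=
    ⟨fun x y hxy ↦ hinj congr(($hxy).1), fun x ↦ by
      obtain ⟨y, hy⟩ := hi x.1 x.2
      exact ⟨y, Subtype.ext hy⟩⟩
  have : Algebra.TensorProduct.productMap i' c' =
    (Algebra.TensorProduct.productMap (AlgHom.equalizer a' p').val c').comp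
      (Algebra.TensorProduct.congr (AlgEquiv.ofBijective ε hε) AlgEquiv.refl).toAlgHom := by
    ext x
    · simp; rfl
    · simp
  rw [this]
  exact key.comp (AlgEquiv.bijective _)

namespace AlgebraicGeometry

open Limits Scheme.AffineZariskiSite

/-! ### Base change and descent of properties of morphisms -/

theorem flat_of_isPullback {X X' Y Y' : Scheme.{u}} {f : X' ⟶ X} {g : Y ⟶ X}
    {g' : Y' ⟶ X'} {r : Y' ⟶ Y} (h : IsPullback r g' g f) [Flat f] : Flat r := by
  rw [← h.isoPullback_hom_fst]
  infer_instance

theorem surjective_of_isPullback {X X' Y Y' : Scheme.{u}} {f : X' ⟶ X} {g : Y ⟶ X}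
    {g' : Y' ⟶ X'} {r : Y' ⟶ Y} (h : IsPullback r g' g f) [Surjective f] : Surjective r := by
  rw [← h.isoPullback_hom_fst]
  infer_instance

theorem isAffineHom_of_isPullback {X X' Y Y' : Scheme.{u}} {f : X' ⟶ X} {g : Y ⟶ X}
    {g' : Y' ⟶ X'} {r : Y' ⟶ Y} (h : IsPullback r g' g f) [IsAffineHom f] : IsAffineHom r :=
  MorphismProperty.IsStableUnderBaseChange.of_isPullback
    (self := isAffineHom_isStableUnderBaseChange) h.flip inferInstance

theorem locallyOfFinitePresentation_of_isPullback {X X' Y Y' : Scheme.{u}} {f : X' ⟶ X} {g : Y ⟶ X}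
    {g' : Y' ⟶ X'} {r : Y' ⟶ Y} (h : IsPullback r g' g f) [LocallyOfFinitePresentation f] :
    LocallyOfFinitePresentation r := by
  rw [← h.isoPullback_hom_fst]
  infer_instance

/-- Affineness descends along a faithfully flat morphism of affine schemes: flat base change of
global sections shows that `Y ⟶ Spec Γ(Y, ⊤)` becomes an isomorphism after base change. -/
theorem isAffine_of_isPullback_of_flat {X X' Y Y' : Scheme.{u}} [IsAffine X] [IsAffine X']
    [CompactSpace Y] [QuasiSeparatedSpace Y] [IsAffine Y'] {f : X' ⟶ X} {g : Y ⟶ X}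
    {g' : Y' ⟶ X'} {r : Y' ⟶ Y} (h : IsPullback r g' g f) [Flat f] [Surjective f] :
    IsAffine Y := by
  have h₁ : IsPushout g.appTop f.appTop r.appTop g'.appTop := by
    have := (isIso_pushoutSection_iff h (US := ⊤) (UT := ⊤) (UX := ⊤) (UY := ⊤) le_top le_top
      (by simp)).mp (isIso_pushoutSection_of_isQuasiSeparated_of_flat_right h _ _ _
        (isAffineOpen_top _) (isAffineOpen_top _) isCompact_univ isQuasiSeparated_univ)
    simpa [Scheme.Hom.appTop, Scheme.Hom.app_eq_appLE] using this
  have h₂ : IsPullback (Spec.map r.appTop) (Spec.map g'.appTop) (Spec.map g.appTop)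
      (Spec.map f.appTop) := (h₁.op.map Scheme.Spec).flip
  have h₃ : IsPullback r Y'.toSpecΓ Y.toSpecΓ (Spec.map r.appTop) := by
    refine IsPullback.of_bot ?_ (Scheme.toSpecΓ_naturality r) h₂
    rw [← Scheme.toSpecΓ_naturality, ← Scheme.toSpecΓ_naturality]
    exact h.paste_vert (.of_vert_isIso ⟨Scheme.toSpecΓ_naturality _⟩)
  have hf : f.appTop.hom.FaithfullyFlat :=
    (Flat.flat_and_surjective_iff_faithfullyFlat_of_isAffine f).mp ⟨inferInstance, inferInstance⟩
  obtain ⟨_, _⟩ := (flat_and_surjective_SpecMap_iff _).mpr hf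
  have := flat_of_isPullback h₂
  have := surjective_of_isPullback h₂
  have : IsIso Y.toSpecΓ :=
    MorphismProperty.of_isPullback_of_descendsAlong (P := .isomorphisms Scheme.{u})
      (Q := @Surjective ⊓ @Flat ⊓ @QuasiCompact) h₃.flip
      ⟨⟨inferInstance, inferInstance⟩, inferInstance⟩
      (inferInstanceAs (IsIso Y'.toSpecΓ))
  exact ⟨this⟩

/-- The property of being an affine morphism descends along fpqc coverings. -/
theorem isAffineHom_of_isPullback_of_flat {X X' Y Y' : Scheme.{u}} {f : X' ⟶ X} {g : Y ⟶ X}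
    {g' : Y' ⟶ X'} {r : Y' ⟶ Y} (h : IsPullback r g' g f) [Flat f] [Surjective f] [QuasiCompact f]
    [QuasiCompact g] [QuasiSeparated g] [IsAffineHom g'] : IsAffineHom g := by
  refine isAffineHom_of_forall_exists_isAffineOpen _ fun x ↦ ?_
  obtain ⟨_, ⟨(U : X.Opens), hU, rfl⟩, hxU, -⟩ :=
      X.isBasis_affineOpens.exists_subset_of_mem_open (Set.mem_univ x) isOpen_univ
  refine ⟨U, hxU, hU, ?_⟩
  have : IsAffine U := hU
  have : CompactSpace (f ⁻¹ᵁ U) := isCompact_iff_compactSpace.mp (f.isCompact_preimage hU.isCompact)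
  have : CompactSpace (g ⁻¹ᵁ U) := isCompact_iff_compactSpace.mp (g.isCompact_preimage hU.isCompact)
  have : QuasiSeparatedSpace (g ⁻¹ᵁ U) :=
    (isQuasiSeparated_iff_quasiSeparatedSpace _ (g ⁻¹ᵁ U).2).mp
      (g.isQuasiSeparated_preimage hU.isQuasiSeparated)
  -- instances that type class search does not find here
  have : IsZariskiLocalAtSource @Flat.{u} :=
    @HasRingHomProperty.instIsZariskiLocalAtSource _ _ Flat.instHasRingHomPropertyFlat
  have : MorphismProperty.ContainsIdentities @Flat.{u} :=
    @MorphismProperty.IsMultiplicative.toContainsIdentities _ _ _ Flat.instIsMultiplicativeScheme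
  -- replace the quasi-compact `f ⁻¹ᵁ U` by an affine scheme `S` that covers it
  obtain ⟨S, p, _, hp, _⟩ := Scheme.exists_hom_isAffine_of_isZariskiLocalAtSource @Flat (f ⁻¹ᵁ U)
  have h₀ : IsPullback (g ⁻¹ᵁ U).ι (g ∣_ U) g U.ι := (isPullback_morphismRestrict g U).flip
  have h₁ : IsPullback (f ⁻¹ᵁ U).ι (f ∣_ U) f U.ι := (isPullback_morphismRestrict f U).flip
  have h₂ : IsPullback (pullback.fst (g ∣_ U) (p ≫ f ∣_ U) ≫ (g ⁻¹ᵁ U).ι)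
      (pullback.snd (g ∣_ U) (p ≫ f ∣_ U)) g ((p ≫ (f ⁻¹ᵁ U).ι) ≫ f) := by
    have := (IsPullback.of_hasPullback (g ∣_ U) (p ≫ f ∣_ U)).paste_horiz h₀
    rwa [Category.assoc, ← h₁.w, ← Category.assoc] at this
  have := isAffineHom_of_isPullback (IsPullback.of_right' h₂ h).flip
  have : IsAffine (pullback (g ∣_ U) (p ≫ f ∣_ U)) :=
    isAffine_of_isAffineHom (pullback.snd (g ∣_ U) (p ≫ f ∣_ U))
  have := surjective_of_isPullback h₁.flip
  have : Flat p := hp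
  exact isAffine_of_isPullback_of_flat (IsPullback.of_hasPullback (g ∣_ U) (p ≫ f ∣_ U))

/-! ### The affine coequalizer -/

/-- The relative spectrum `π : T ⟶ W` of a quasi-coherent algebra `F`, the latter given by its
values on affine opens and the condition that restriction to a basic open is localization. -/
theorem exists_relativeSpec {W : Scheme.{u}} {F : W.AffineZariskiSiteᵒᵖ ⥤ CommRingCat.{u}}
    {α : (toOpensFunctor W).op ⋙ W.presheaf ⟶ F} (H : α.Coequifibered) :
    ∃ (T : Scheme.{u}) (π : T ⟶ W) (ι : ∀ U : W.AffineZariskiSite, Spec (F.obj (.op U)) ⟶ T),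
      (∀ U, IsOpenImmersion (ι U)) ∧
      (∀ U, ι U ≫ π = Spec.map (α.app (.op U)) ≫ U.2.fromSpec) ∧
      (∀ U, (π ⁻¹ᵁ U.1 : Set T) = Set.range (ι U)) ∧
      ∀ {U V : W.AffineZariskiSite} (i : U ⟶ V), Spec.map (F.map i.op) ≫ ι V = ι U := by
  have : ((relativeGluingData H).functor ⋙ Scheme.forget).IsLocallyDirected :=
    Scheme.Cover.RelativeGluingData.instIsLocallyDirectedI₀CompFunctorForgetOfIsThin ..
  let ι (U : W.AffineZariskiSite) : Spec (F.obj (.op U)) ⟶ (relativeGluingData H).glued :=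
    colimit.ι (relativeGluingData H).functor U
  have h₁ (U) : IsOpenImmersion (ι U) :=
    Scheme.IsLocallyDirected.instIsOpenImmersionι (relativeGluingData H).functor U
  refine ⟨(relativeGluingData H).glued, (relativeGluingData H).toBase, ι, h₁, fun U ↦ ?_,
    fun U ↦ ?_, fun i ↦ ?_⟩
  · exact (colimit.ι_desc _ _)
  · refine Eq.trans ?_ ((relativeGluingData H).preimage_toBase_eq_range_ι U)
    exact congrArg (fun V ↦ (relativeGluingData H).toBase ⁻¹' V) (Scheme.Opens.range_ι U.1).symm
  · exact colimit.w (relativeGluingData H).functor i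

section EqualizerAlgebra

variable {R T' W : Scheme.{u}} (a p : R ⟶ T') (t : T' ⟶ W) (h : a ≫ t = p ≫ t)

/-- For a morphism `a : R ⟶ T'` of schemes over `W`, the pullback of sections along `a` over the
preimage of an open `U` of `W`. The structure morphism of `R` is a variable `r`, so that these maps
for different morphisms have the same source and target. -/
noncomputable abbrev sectionsMap {r : R ⟶ W} (ha : a ≫ t = r) (U : W.Opens) :
    Γ(T', t ⁻¹ᵁ U) ⟶ Γ(R, r ⁻¹ᵁ U) :=
  a.appLE (t ⁻¹ᵁ U) (r ⁻¹ᵁ U) (by subst ha; rfl)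

theorem sectionsMap_naturality {r : R ⟶ W} (ha : a ≫ t = r) {U V : W.Opens} (i : U ⟶ V) :
    T'.presheaf.map (homOfLE (t.preimage_mono i.le)).op ≫ sectionsMap a t ha U =
      sectionsMap a t ha V ≫ R.presheaf.map (homOfLE (r.preimage_mono i.le)).op := by
  rw [sectionsMap, sectionsMap, Scheme.Hom.map_appLE, Scheme.Hom.appLE_map]

theorem app_comp_sectionsMap {r : R ⟶ W} (ha : a ≫ t = r) (U : W.Opens) :
    t.app U ≫ sectionsMap a t ha U = r.app U := by
  subst ha
  rw [sectionsMap, Scheme.Hom.app_eq_appLE, Scheme.Hom.appLE_comp_appLE, Scheme.Hom.app_eq_appLE]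

/-- The sections over the preimage of `U` in `T'` whose pullbacks along `a` and `p` agree. -/
noncomputable abbrev equalizerSections (U : W.Opens) : Subring Γ(T', t ⁻¹ᵁ U) :=
  RingHom.eqLocus (sectionsMap a t h U).hom (sectionsMap p t rfl U).hom

/-- The restriction maps of `equalizerSections`. -/
noncomputable def equalizerSectionsRes {U V : W.Opens} (i : U ⟶ V) :
    equalizerSections a p t h V →+* equalizerSections a p t h U :=
  ((T'.presheaf.map (homOfLE (t.preimage_mono i.le)).op).hom.comp
    (Subring.subtype _)).codRestrict _ fun x ↦ by
      have hx : (sectionsMap a t h V).hom x.1 = (sectionsMap p t rfl V).hom x.1 := x.2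
      have h₁ := congr($(sectionsMap_naturality a t h i) x.1)
      have h₂ := congr($(sectionsMap_naturality p t rfl i) x.1)
      have h₃ := congrArg (R.presheaf.map (homOfLE ((p ≫ t).preimage_mono i.le)).op) hx
      exact h₁.trans (h₃.trans h₂.symm)

/-- The structure map of `equalizerSections` as an algebra over the functions on the base. -/
noncomputable def toEqualizerSections (U : W.Opens) : Γ(W, U) →+* equalizerSections a p t h U :=
  (t.app U).hom.codRestrict _ fun x ↦ by
    have h₁ := congr($(app_comp_sectionsMap a t h U) x)
    have h₂ := congr($(app_comp_sectionsMap p t rfl U) x)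
    exact h₁.trans h₂.symm

/-- `equalizerSections` as a presheaf of rings on the affine opens of `W`. -/
noncomputable def equalizerAlgebra : W.AffineZariskiSiteᵒᵖ ⥤ CommRingCat.{u} where
  obj U := .of (equalizerSections a p t h U.unop.1)
  map i := CommRingCat.ofHom (equalizerSectionsRes a p t h ((toOpensFunctor W).map i.unop))
  map_id U := by
    ext x
    exact congr($(T'.presheaf.map_id _) x.1)
  map_comp i j := by
    ext x
    exact congr($(T'.presheaf.map_comp
      (homOfLE (t.preimage_mono ((toOpensFunctor W).map i.unop).le)).op
      (homOfLE (t.preimage_mono ((toOpensFunctor W).map j.unop).le)).op) x.1)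

/-- The structure map of `equalizerAlgebra` as an algebra over the structure sheaf of `W`. -/
noncomputable def equalizerAlgebraMap :
    (toOpensFunctor W).op ⋙ W.presheaf ⟶ equalizerAlgebra a p t h where
  app U := CommRingCat.ofHom (toEqualizerSections a p t h U.unop.1)
  naturality {U V} i := by
    ext x
    apply Subtype.ext
    exact congr($(t.naturality ((toOpensFunctor W).map i.unop).op) x)

/-- Over an affine scheme, the algebra of sections equalized by `a` and `p` is quasi-coherent. -/
theorem coequifibered_equalizerAlgebraMap [IsAffineHom t] [IsAffineHom (p ≫ t)] :
    (equalizerAlgebraMap a p t h).Coequifibered := by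
  refine coequifibered_iff_forall_isLocalizationAway.mpr fun U f ↦ ?_
  have hle : t ⁻¹ᵁ W.basicOpen f ≤ t ⁻¹ᵁ U.1 := t.preimage_mono (W.basicOpen_le f)
  have hle' : (p ≫ t) ⁻¹ᵁ W.basicOpen f ≤ (p ≫ t) ⁻¹ᵁ U.1 :=
    (p ≫ t).preimage_mono (W.basicOpen_le f)
  let := (T'.presheaf.map (homOfLE hle).op).hom.toAlgebra
  let := (R.presheaf.map (homOfLE hle').op).hom.toAlgebra
  have h₁ : IsLocalization.Away (t.app U.1 f) Γ(T', t ⁻¹ᵁ W.basicOpen f) :=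
    (U.2.preimage t).isLocalization_of_eq_basicOpen _ (homOfLE hle) (t.preimage_basicOpen f)
  have h₂ : IsLocalization.Away ((sectionsMap p t rfl U.1).hom (t.app U.1 f))
      Γ(R, (p ≫ t) ⁻¹ᵁ W.basicOpen f) := by
    have : (sectionsMap p t rfl U.1).hom (t.app U.1 f) = (p ≫ t).app U.1 f :=
      congr($(app_comp_sectionsMap p t rfl U.1) f)
    rw [this]
    exact (U.2.preimage (p ≫ t)).isLocalization_of_eq_basicOpen _ (homOfLE hle')
      ((p ≫ t).preimage_basicOpen f)
  let : Algebra (equalizerSections a p t h U.1) (equalizerSections a p t h (W.basicOpen f)) :=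
    (equalizerSectionsRes a p t h (homOfLE (W.basicOpen_le f))).toAlgebra
  have h₃ (m) := congr($(sectionsMap_naturality a t h (homOfLE (W.basicOpen_le f))) m)
  have h₄ (m) := congr($(sectionsMap_naturality p t rfl (homOfLE (W.basicOpen_le f))) m)
  have h₅ : IsLocalization.Away (toEqualizerSections a p t h U.1 f).1
    Γ(T', t ⁻¹ᵁ W.basicOpen f) := h₁
  have h₆ : IsLocalization.Away
    ((sectionsMap p t rfl U.1).hom (toEqualizerSections a p t h U.1 f).1)
    Γ(R, (p ≫ t) ⁻¹ᵁ W.basicOpen f) := h₂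
  exact RingHom.isLocalizationAway_eqLocus (sectionsMap a t h U.1).hom
    (sectionsMap p t rfl U.1).hom (sectionsMap a t h (W.basicOpen f)).hom
    (sectionsMap p t rfl (W.basicOpen f)).hom h₃ h₄ (fun m ↦ rfl)
    (toEqualizerSections a p t h U.1 f)

end EqualizerAlgebra

/-- Morphisms out of `T'` can be glued from morphisms on the preimages of the affine opens of a
base `W`; compatibility is only needed for the inclusions of basic opens. -/
theorem exists_hom_of_forall_affineOpens {T' T W : Scheme.{u}} (t : T' ⟶ W)
    (g : ∀ U : W.affineOpens, (t ⁻¹ᵁ U.1).toScheme ⟶ T)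
    (hg : ∀ (U V : W.affineOpens) (_ : ∃ f : Γ(W, V.1), W.basicOpen f = U.1) (hUV : U.1 ≤ V.1),
      T'.homOfLE (t.preimage_mono hUV) ≫ g V = g U) :
    ∃ q : T' ⟶ T, ∀ U, (t ⁻¹ᵁ U.1).ι ≫ q = g U := by
  have h₁ (U V : W.affineOpens) (h : ∃ f : Γ(W, V.1), W.basicOpen f = U.1) (hUV : U.1 ≤ V.1) :
      pullback.map t U.1.ι t V.1.ι (𝟙 _) (W.homOfLE hUV) (𝟙 _)
        (by simp) (by simp) ≫ (pullbackRestrictIsoRestrict t V.1).hom ≫ g V =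
      (pullbackRestrictIsoRestrict t U.1).hom ≫ g U := by
    rw [← hg U V h hUV, ← Category.assoc, ← Category.assoc]
    congr 1
    rw [← cancel_mono (Scheme.Opens.ι _), Category.assoc, Category.assoc,
      pullbackRestrictIsoRestrict_hom_ι]
    refine Eq.trans ?_ (congrArg ((pullbackRestrictIsoRestrict t U.1).hom ≫ ·)
      (Scheme.homOfLE_ι T' (t.preimage_mono hUV))).symm
    rw [pullbackRestrictIsoRestrict_hom_ι]
    exact (pullback.lift_fst _ _ _).trans (Category.comp_id _)
  have h₂ {U V : W.AffineZariskiSite} (i : U ⟶ V) := h₁ U V (i.le) (toOpens_mono i.le)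
  refine ⟨Scheme.OpenCover.glueMorphismsOfLocallyDirected ((directedCover W).pullback₁ t)
    (fun U : W.affineOpens ↦ (pullbackRestrictIsoRestrict t U.1).hom ≫ g U) fun i ↦ h₂ i,
    fun U ↦ ?_⟩
  rw [← cancel_epi (pullbackRestrictIsoRestrict t U.1).hom]
  refine Eq.trans ?_ (Scheme.OpenCover.map_glueMorphismsOfLocallyDirected
    ((directedCover W).pullback₁ t) _ (fun i ↦ h₂ i) U)
  rw [← Category.assoc]
  refine congrArg (· ≫ _) ?_
  exact pullbackRestrictIsoRestrict_hom_ι t U.1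

theorem hom_ext_of_forall_affineOpens {T' T W : Scheme.{u}} (t : T' ⟶ W) {g g' : T' ⟶ T}
    (hg : ∀ U : W.affineOpens, (t ⁻¹ᵁ U.1).ι ≫ g = (t ⁻¹ᵁ U.1).ι ≫ g') : g = g' :=
  Scheme.Cover.hom_ext (T'.openCoverOfIsOpenCover (fun U : W.affineOpens ↦ t ⁻¹ᵁ U.1)
    (.comap (iSup_affineOpens_eq_top W) t.base.1)) _ _ hg

theorem isIso_appLE_of_eq_opensRange {X Y : Scheme.{u}} (f : X ⟶ Y) [IsOpenImmersion f]
    (V : Y.Opens) (hV : V = f.opensRange) (e) : IsIso (f.appLE V ⊤ e) := by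
  obtain rfl : V = f ''ᵁ ⊤ := hV.trans f.image_top_eq_opensRange.symm
  rw [← f.appIso_hom']
  infer_instance

theorem toSpecΓ_app_fromSpec {X Y : Scheme.{u}} (f : X ⟶ Y) {U : Y.Opens} (hU : IsAffineOpen U) :
    (f ⁻¹ᵁ U).toSpecΓ ≫ Spec.map (f.app U) ≫ hU.fromSpec = (f ⁻¹ᵁ U).ι ≫ f := by
  rw [Scheme.Opens.toSpecΓ_naturality_assoc, IsAffineOpen.toSpecΓ_fromSpec, morphismRestrict_ι]

theorem appLE_eq_of_ι_comp_eq {X Y : Scheme.{u}} {A : CommRingCat.{u}} (f : X ⟶ Y) (U : X.Opens)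
    (φ : A ⟶ Γ(X, U)) (i : Spec A ⟶ Y) (h : U.ι ≫ f = U.toSpecΓ ≫ Spec.map φ ≫ i)
    (V : Y.Opens) (hi : ⊤ ≤ i ⁻¹ᵁ V) (hf : U ≤ f ⁻¹ᵁ V) :
    f.appLE V U hf = (i.appLE V ⊤ hi ≫ (Scheme.ΓSpecIso A).hom) ≫ φ := by
  rw [← cancel_mono U.topIso.inv]
  have h₀ : ⊤ ≤ U.ι ⁻¹ᵁ f ⁻¹ᵁ V := fun x _ ↦ hf x.2
  have h₁ : (U.ι ≫ f).appLE V ⊤ h₀ = f.appLE V U hf ≫ U.topIso.inv := by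
    rw [← Scheme.Hom.appLE_comp_appLE _ _ V U ⊤ hf (by simp)]
    congr 1
    rw [Scheme.Opens.ι_appLE]
    rfl
  have h₂ (k : U.toScheme ⟶ Spec A) (e) :
      (k ≫ i).appLE V ⊤ e = i.appLE V ⊤ hi ≫ k.appTop := by
    rw [← Scheme.Hom.appLE_comp_appLE _ _ V ⊤ ⊤ hi le_top]
    simp [Scheme.Hom.appTop, Scheme.Hom.app_eq_appLE]
  rw [← h₁]
  simp only [h]
  simp only [← Category.assoc U.toSpecΓ]
  rw [h₂, Scheme.Hom.comp_appTop, Scheme.Opens.toSpecΓ_appTop, Scheme.ΓSpecIso_naturality_assoc]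
  simp only [Category.assoc]

theorem ι_comp_comp_eq {R X Y : Scheme.{u}} (b : R ⟶ X) (q : X ⟶ Y) {V : X.Opens}
    (k : Spec Γ(X, V) ⟶ Y) (h : V.ι ≫ q = V.toSpecΓ ≫ k) (V' : R.Opens) (e : V' ≤ b ⁻¹ᵁ V) :
    V'.ι ≫ b ≫ q = V'.toSpecΓ ≫ Spec.map (b.appLE V V' e) ≫ k := by
  rw [Scheme.Opens.toSpecΓ_SpecMap_appLE_assoc, ← h, Scheme.Hom.resLE_comp_ι_assoc]

section Coequalizer

variable {R T' W : Scheme.{u}} (a p : R ⟶ T') (t : T' ⟶ W) (h : a ≫ t = p ≫ t)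

/-- The relative spectrum of the algebra of sections equalized by `a` and `p`, described by its
charts `ι U`. -/
theorem exists_relativeSpec_equalizerSections [IsAffineHom t] [IsAffineHom (p ≫ t)] :
    ∃ (T : Scheme.{u}) (π : T ⟶ W)
      (ι : ∀ U : W.affineOpens, Spec (.of (equalizerSections a p t h U.1)) ⟶ T),
      (∀ U, IsOpenImmersion (ι U)) ∧
      (∀ U, ι U ≫ π =
        Spec.map (CommRingCat.ofHom (toEqualizerSections a p t h U.1)) ≫ U.2.fromSpec) ∧
      (∀ U, (π ⁻¹ᵁ U.1 : Set T) = Set.range (ι U)) ∧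
      ∀ (U V : W.affineOpens) (_ : ∃ f : Γ(W, V.1), W.basicOpen f = U.1) (hUV : U.1 ≤ V.1),
        Spec.map (CommRingCat.ofHom (equalizerSectionsRes a p t h (homOfLE hUV))) ≫ ι V =
          ι U := by
  obtain ⟨T, π, ι, hι, hιπ, hπ, hF⟩ :=
    exists_relativeSpec (coequifibered_equalizerAlgebraMap a p t h)
  refine ⟨T, π, ι, hι, hιπ, hπ, fun U V h hUV ↦ ?_⟩
  exact hF (U := U) (V := V)
    (homOfLE (@id (@LE.le W.AffineZariskiSite Preorder.toLE U V) h))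

/-- Two morphisms `a`, `p` to an affine `W`-scheme `T'` have a common factorization `q : T' ⟶ T`,
where `T` is affine over `W` and its functions are the functions on `T'` equalized by `a` and `p`. -/
theorem exists_affine_coequalizer [IsAffineHom t] [IsAffineHom (p ≫ t)] :
    ∃ (T : Scheme.{u}) (π : T ⟶ W) (q : T' ⟶ T) (hq : q ≫ π = t), IsAffineHom π ∧
      a ≫ q = p ≫ q ∧ ∀ U : W.Opens, IsAffineOpen U →
        Function.Injective (sectionsMap q π hq U) ∧
        ∀ s ∈ equalizerSections a p t h U, ∃ s', sectionsMap q π hq U s' = s := by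
  obtain ⟨T, π, ι, hι, hιπ, hπ, hF⟩ := exists_relativeSpec_equalizerSections a p t h
  let g (U : W.affineOpens) : (t ⁻¹ᵁ U.1).toScheme ⟶ T := (t ⁻¹ᵁ U.1).toSpecΓ ≫
    Spec.map (CommRingCat.ofHom (equalizerSections a p t h U.1).subtype) ≫ ι U
  obtain ⟨q, hq⟩ := exists_hom_of_forall_affineOpens t g fun U V h hUV ↦ by
    dsimp only [g]
    rw [← hF U V h hUV, ← Scheme.Opens.toSpecΓ_SpecMap_presheaf_map_assoc, ← Spec.map_comp_assoc,
      ← Spec.map_comp_assoc]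
    rfl
  have hqπ : q ≫ π = t := by
    refine hom_ext_of_forall_affineOpens t fun U ↦ ?_
    rw [← Category.assoc, hq U]
    dsimp only [g]
    rw [Category.assoc, Category.assoc, hιπ, ← Spec.map_comp_assoc]
    exact toSpecΓ_app_fromSpec t U.2
  have haq (r : R ⟶ W) (b : R ⟶ T') (hb : b ≫ t = r) (U : W.affineOpens) :
      (r ⁻¹ᵁ U.1).ι ≫ b ≫ q = (r ⁻¹ᵁ U.1).toSpecΓ ≫ Spec.map
        (CommRingCat.ofHom (equalizerSections a p t h U.1).subtype ≫ sectionsMap b t hb U.1) ≫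
          ι U := by
    subst hb
    rw [Spec.map_comp, Category.assoc]
    exact ι_comp_comp_eq b q _ (hq U) _ _
  refine ⟨T, π, q, hqπ, ?_, ?_, fun U hU ↦ ?_⟩
  · refine isAffineHom_of_forall_exists_isAffineOpen _ fun x ↦ ?_
    obtain ⟨_, ⟨(U : W.Opens), hU, rfl⟩, hxU, -⟩ :=
        W.isBasis_affineOpens.exists_subset_of_mem_open (Set.mem_univ x) isOpen_univ
    refine ⟨U, hxU, hU, ?_⟩
    have := hι ⟨U, hU⟩
    rw [show π ⁻¹ᵁ U = (ι ⟨U, hU⟩).opensRange from TopologicalSpace.Opens.ext (hπ ⟨U, hU⟩)]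
    exact isAffineOpen_opensRange _
  · refine hom_ext_of_forall_affineOpens (p ≫ t) fun U ↦ ?_
    refine (haq _ a h U).trans (.trans ?_ (haq _ p rfl U).symm)
    congr 3
    ext x
    exact x.2
  · have := hι ⟨U, hU⟩
    have hV : π ⁻¹ᵁ U = (ι ⟨U, hU⟩).opensRange := TopologicalSpace.Opens.ext (hπ ⟨U, hU⟩)
    have hV' : ⊤ ≤ ι ⟨U, hU⟩ ⁻¹ᵁ π ⁻¹ᵁ U := by rw [hV]; exact fun x _ ↦ ⟨x, rfl⟩
    let θ := (ι ⟨U, hU⟩).appLE (π ⁻¹ᵁ U) ⊤ hV' ≫ (Scheme.ΓSpecIso _).hom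
    have hθ : IsIso ((ι ⟨U, hU⟩).appLE (π ⁻¹ᵁ U) ⊤ hV') :=
      isIso_appLE_of_eq_opensRange _ _ hV _
    have hφ : sectionsMap q π hqπ U =
        θ ≫ CommRingCat.ofHom (equalizerSections a p t h U).subtype :=
      appLE_eq_of_ι_comp_eq q _ _ _ (hq ⟨U, hU⟩) _ hV' _
    have hθ' : Function.Bijective θ := ConcreteCategory.bijective_of_isIso θ
    rw [hφ]
    refine ⟨?_, fun s hs ↦ ?_⟩
    · exact Subtype.val_injective.comp hθ'.1
    · obtain ⟨s', hs'⟩ := hθ'.2 ⟨s, hs⟩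
      exact ⟨s', congrArg Subtype.val hs'⟩

end Coequalizer

/-! ### Effective descent for affine morphisms -/

/-- A cartesian square of affine `W`-schemes gives pushout squares of rings of sections. -/
theorem isPushout_sectionsMap {T' T Q W : Scheme.{u}} {q : T' ⟶ T} {h : T' ⟶ Q} {π : T ⟶ W}
    {ρ : Q ⟶ W} (H : IsPullback q h π ρ) [IsAffineHom π] [IsAffineHom ρ] {t : T' ⟶ W}
    (hq : q ≫ π = t) (hh : h ≫ ρ = t) {U : W.Opens} (hU : IsAffineOpen U) :
    IsPushout (π.app U) (ρ.app U) (sectionsMap q π hq U) (sectionsMap h ρ hh U) := by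
  rw [Scheme.Hom.app_eq_appLE, Scheme.Hom.app_eq_appLE]
  have e : t ⁻¹ᵁ U = q ⁻¹ᵁ π ⁻¹ᵁ U ⊓ h ⁻¹ᵁ ρ ⁻¹ᵁ U := by
    rw [← Scheme.Hom.comp_preimage, ← Scheme.Hom.comp_preimage, hq, hh, inf_idem]
  exact (isIso_pushoutSection_iff H le_rfl le_rfl e).mp
    (isIso_pushoutSection_of_isAffineOpen H le_rfl le_rfl e hU (hU.preimage ρ) (hU.preimage π))

/-- A square of affine `W`-schemes is cartesian if it induces pushout squares of rings of sections
over the affine opens of `W`. -/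
theorem isPullback_of_isPushout_sectionsMap {T' T Q W : Scheme.{u}} {q : T' ⟶ T} {h : T' ⟶ Q}
    {π : T ⟶ W} {ρ : Q ⟶ W} [IsAffineHom π] [IsAffineHom ρ] {t : T' ⟶ W} [IsAffineHom t]
    (hq : q ≫ π = t) (hh : h ≫ ρ = t)
    (H : ∀ U : W.Opens, IsAffineOpen U →
      IsPushout (π.app U) (ρ.app U) (sectionsMap q π hq U) (sectionsMap h ρ hh U)) :
    IsPullback q h π ρ := by
  let φ : T' ⟶ pullback π ρ := pullback.lift q h (hq.trans hh.symm)
  let r := pullback.fst π ρ ≫ π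
  have hφ : φ ≫ r = t := by rw [pullback.lift_fst_assoc, hq]
  have hr₀ : IsAffineHom (pullback.fst π ρ) :=
    isAffineHom_of_isPullback (IsPullback.of_hasPullback π ρ)
  have hr : IsAffineHom r := inferInstanceAs (IsAffineHom (pullback.fst π ρ ≫ π))
  have : IsAffineHom φ := by
    have : IsAffineHom (φ ≫ r) := by rwa [hφ]
    exact .of_comp φ r
  have : IsIso φ := by
    refine (IsZariskiLocalAtTarget.iff_of_iSup_eq_top (P := .isomorphisms Scheme.{u})
      (fun U : W.affineOpens ↦ r ⁻¹ᵁ U.1) ?_).mpr fun U ↦ ?_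
    · exact TopologicalSpace.IsOpenCover.comap (iSup_affineOpens_eq_top W) r.base.1
    · refine (isIso_morphismRestrict_iff_isIso_app φ (U.2.preimage r)).mpr ?_
      have h₁ := isPushout_sectionsMap (IsPullback.of_hasPullback π ρ) (t := r) rfl
        pullback.condition.symm U.2
      have h₃ : IsIso (sectionsMap φ r hφ U.1) := by
        refine (h₁.iff_isIso ?_ ?_).mp (H U.1 U.2)
        · rw [sectionsMap, sectionsMap, Scheme.Hom.appLE_comp_appLE]
          simp only [φ, pullback.lift_fst]
        · rw [sectionsMap, sectionsMap, Scheme.Hom.appLE_comp_appLE]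
          simp only [φ, pullback.lift_snd]
      have h₄ {t : T' ⟶ W} (ht : φ ≫ r = t) (h : IsIso (sectionsMap φ r ht U.1)) :
          IsIso (φ.app (r ⁻¹ᵁ U.1)) := by
        subst ht
        rw [Scheme.Hom.app_eq_appLE]
        exact h
      exact h₄ hφ h₃
  exact .of_iso_pullback ⟨hq.trans hh.symm⟩ (asIso φ) (pullback.lift_fst _ _ _)
    (pullback.lift_snd _ _ _)

theorem sectionsMap_comp {R R₂ T' W : Scheme.{u}} (b : R ⟶ T') (b' : R₂ ⟶ R) (t : T' ⟶ W)
    {r : R ⟶ W} {r₂ : R₂ ⟶ W} (hb : b ≫ t = r) (hb' : b' ≫ r = r₂) (U : W.Opens) :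
    sectionsMap b t hb U ≫ sectionsMap b' r hb' U =
      sectionsMap (b' ≫ b) t (by rw [Category.assoc, hb, hb']) U := by
  rw [sectionsMap, sectionsMap, Scheme.Hom.appLE_comp_appLE]

/-- Effective descent for affine schemes along a morphism `ρ` that is a torsor after base change:
`Q ⟶ W` plays the role of the torsor, `T'` carries an action (encoded by `R = G × T'`,
`R₂ = G × G × T'` and the structure maps between them) and `h : T' ⟶ Q` is equivariant. Then `T'`
is the base change along `ρ` of an affine `W`-scheme `T`. -/
theorem exists_isPullback_of_descentDatum {R R₂ T' Q W : Scheme.{u}} {ρ : Q ⟶ W} [IsAffineHom ρ]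
    [Flat ρ] {t : T' ⟶ W} [IsAffineHom t] {h : T' ⟶ Q} {a p : R ⟶ T'} {j : R ⟶ Q} {e : T' ⟶ R}
    {p₂ : R₂ ⟶ R} {j₂ : R₂ ⟶ Q} {α β : R₂ ⟶ R} (hh : h ≫ ρ = t) (hat : a ≫ t = p ≫ t)
    (hR : IsPullback p j t ρ) (hR₂ : IsPullback p₂ j₂ (p ≫ t) ρ) (haj : a ≫ h = j)
    (hea : e ≫ a = 𝟙 T') (hαp : α ≫ p = p₂ ≫ a) (hαj : α ≫ j = j₂) (hβp : β ≫ p = p₂ ≫ p)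
    (hβj : β ≫ j = j₂) (hαβ : α ≫ a = β ≫ a) :
    ∃ (T : Scheme.{u}) (π : T ⟶ W) (q : T' ⟶ T),
      IsAffineHom π ∧ q ≫ π = t ∧ a ≫ q = p ≫ q ∧ IsPullback q h π ρ := by
  have : IsAffineHom p := isAffineHom_of_isPullback hR
  have hpt : IsAffineHom (p ≫ t) := inferInstance
  obtain ⟨T, π, q, hq, hπ, hapq, H⟩ := exists_affine_coequalizer a p t hat
  refine ⟨T, π, q, hπ, hq, hapq, isPullback_of_isPushout_sectionsMap hq hh fun U hU ↦ ?_⟩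
  have hep : e ≫ p ≫ t = t := by rw [← hat, reassoc_of% hea]
  have hα : α ≫ p ≫ t = p₂ ≫ p ≫ t := by rw [reassoc_of% hαp, hat]
  have hβ : β ≫ p ≫ t = p₂ ≫ p ≫ t := by rw [reassoc_of% hβp]
  have hjt : j ≫ ρ = p ≫ t := hR.w.symm
  have hjt₂ : j₂ ≫ ρ = p₂ ≫ p ≫ t := hR₂.w.symm
  have hflat : (ρ.app U).hom.Flat := by
    rw [Scheme.Hom.app_eq_appLE]
    exact Flat.flat_appLE ρ hU (hU.preimage ρ) _
  refine CommRingCat.isPushout_of_descentDatum (a := sectionsMap a t hat U)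
    (p := sectionsMap p t rfl U) (j := sectionsMap j ρ hjt U) (e := sectionsMap e (p ≫ t) hep U)
    (p₂ := sectionsMap p₂ (p ≫ t) rfl U) (j₂ := sectionsMap j₂ ρ hjt₂ U)
    (α := sectionsMap α (p ≫ t) hα U) (β := sectionsMap β (p ≫ t) hβ U) hflat
    (app_comp_sectionsMap q π hq U) (app_comp_sectionsMap h ρ hh U) ?_ (H U hU).1 ?_ (H U hU).2
    (isPushout_sectionsMap hR rfl hjt hU) ?_ ?_ ?_ ?_ ?_ ?_ ?_ ?_
  · rw [app_comp_sectionsMap, app_comp_sectionsMap]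
  · rw [sectionsMap_comp, sectionsMap_comp]
    simp only [hapq]
  · rw [app_comp_sectionsMap]
    exact isPushout_sectionsMap hR₂ rfl hjt₂ hU
  · rw [sectionsMap_comp]
    simp only [haj]
  · rw [sectionsMap_comp]
    simp only [hea]
    rw [sectionsMap, Scheme.Hom.appLE, Scheme.Hom.id_app]
    exact (Category.id_comp _).trans (T'.presheaf.map_id _)
  · rw [sectionsMap_comp, sectionsMap_comp]
    simp only [hαp]
  · rw [sectionsMap_comp]
    simp only [hαj]
  · rw [sectionsMap_comp, sectionsMap_comp]
    simp only [hβp]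
  · rw [sectionsMap_comp]
    simp only [hβj]
  · rw [sectionsMap_comp, sectionsMap_comp]
    simp only [hαβ]

end AlgebraicGeometry

namespace ZeroCycleDescent

open Limits
open scoped MonObj

/-! ### Quotients by group actions -/

section CartesianMonoidal

universe v w

variable {C : Type w} [Category.{v} C] [CartesianMonoidalCategory C]

theorem isPullback_snd_whiskerLeft (G : C) {X Y : C} (f : X ⟶ Y) :
    IsPullback (snd G X) (G ◁ f) f (snd G Y) := by
  refine ⟨⟨by simp⟩, ⟨PullbackCone.IsLimit.mk _ (fun s ↦ lift (s.snd ≫ fst G Y) s.fst) ?_ ?_ ?_⟩⟩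
  · intro s; simp
  · intro s
    ext
    · simp
    · simp [s.condition]
  · intro s m h₁ h₂
    ext
    · simp [← h₂]
    · simp [← h₁]

/-- Associativity of an action on `(g', (g, y))`: `(g' g) y = g' (g y)`. -/
theorem smul_whiskerLeft_smul {G : C} [MonObj G] (Y : C) [ModObj G Y] :
    lift (lift (fst G (G ⊗ Y)) (snd G (G ⊗ Y) ≫ fst G Y) ≫ μ[G]) (snd G (G ⊗ Y) ≫ snd G Y) ≫
      γ[G, Y] = G ◁ γ[G, Y] ≫ γ[G, Y] := by
  rw [← cancel_epi (α_ G G Y).hom, ← ModObj.mul_smul_self, ← Category.assoc]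
  congr 1
  have h : (α_ G G Y).hom ≫ lift (fst G (G ⊗ Y)) (snd G (G ⊗ Y) ≫ fst G Y) = fst (G ⊗ G) Y := by
    ext <;> simp
  ext
  · rw [Category.assoc, lift_fst, ← Category.assoc, h, whiskerRight_fst]
  · simp

/-- The unit section `y ↦ (1, y)` is a section of the action. -/
theorem one_smul_lift {G : C} [MonObj G] (Y : C) [ModObj G Y] :
    lift (toUnit Y ≫ η[G]) (𝟙 Y) ≫ γ[G, Y] = 𝟙 Y := by
  have : lift (toUnit Y ≫ η[G]) (𝟙 Y) = (λ_ Y).inv ≫ η[G] ▷ Y := by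
    ext <;> simp
  rw [this, Category.assoc, ModObj.one_smul_self, Iso.inv_hom_id]

end CartesianMonoidal

section Quotient

variable {B : Scheme.{u}} {G : Over B} [GrpObj G]

/-- If `h' : T' ⟶ P` is an equivariant morphism to a torsor `P ⟶ L`, then `G × T'` is the fibre
product of `T'` and `P` over `L`, through `(g, y) ↦ (y, g h'(y))`. -/
theorem IsTorsor.isPullback_smul_comp {P L T' : Over B} [ModObj G P] [ModObj G T'] {p : P ⟶ L}
    (hp : IsTorsor G p) (h' : T' ⟶ P) (hh' : γ[G, T'] ≫ h' = G ◁ h' ≫ γ[G, P]) :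
    IsPullback (snd G T') (γ[G, T'] ≫ h') (h' ≫ p) p := by
  rw [hh']
  exact (isPullback_snd_whiskerLeft G h').flip.paste_horiz hp.isPullback.flip |>.flip

/-- The base change `q : T' ⟶ T` of a torsor `p : P ⟶ L` is a torsor for an action on `T'` that is
trivial on `T` and for which `T' ⟶ P` is equivariant. -/
theorem IsTorsor.of_isPullback {P L T' T : Over B} [ModObj G P] [ModObj G T'] {p : P ⟶ L}
    (hp : IsTorsor G p) {h' : T' ⟶ P} (hh' : γ[G, T'] ≫ h' = G ◁ h' ≫ γ[G, P]) {q : T' ⟶ T}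
    {v : T ⟶ L} (H : IsPullback q h' v p) (hq : γ[G, T'] ≫ q = snd G T' ≫ q) :
    IsTorsor G q := by
  have H' : IsPullback q.left h'.left v.left p.left := H.map (Over.forget B)
  have := hp.flat
  have := hp.surjective
  have := hp.locallyOfFinitePresentation
  refine ⟨flat_of_isPullback H', surjective_of_isPullback H',
    locallyOfFinitePresentation_of_isPullback H', ?_⟩
  refine (IsPullback.of_right (h₁₂ := h') (h₂₂ := v) (v₁₃ := p) ?_ hq H.flip).flip
  rw [H.w]
  exact (hp.isPullback_smul_comp h' hh').flip

/-- Let `P ⟶ L` be an affine torsor and `T' ⟶ P` equivariant over `W ⟶ L`, with `T'` affine over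
`W`. Then `T'` has a quotient by the group, which is affine over `W`, and `T'` is a torsor over it. -/
theorem IsTorsor.exists_quotient {P L T' W : Over B} [ModObj G P] [ModObj G T'] {p : P ⟶ L}
    (hp : IsTorsor G p) [IsAffineHom p.left] {h' : T' ⟶ P}
    (hh' : γ[G, T'] ≫ h' = G ◁ h' ≫ γ[G, P]) {t : T' ⟶ W} [IsAffineHom t.left]
    (ht : γ[G, T'] ≫ t = snd G T' ≫ t) {w : W ⟶ L} (hw : t ≫ w = h' ≫ p) :
    ∃ (T : Over B) (q : T' ⟶ T) (π : T ⟶ W), IsAffineHom π.left ∧ q ≫ π = t ∧ IsTorsor G q := by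
  let ρ : pullback w p ⟶ W := pullback.fst w p
  let h : T' ⟶ pullback w p := pullback.lift t h' hw
  have hQ : IsPullback ρ (pullback.snd w p) w p := .of_hasPullback w p
  have hQ' : IsPullback ρ.left (pullback.snd w p).left w.left p.left := hQ.map (Over.forget B)
  have := hp.flat
  have := flat_of_isPullback hQ'
  have := isAffineHom_of_isPullback hQ'
  have hR : IsPullback (snd G T') (γ[G, T'] ≫ h) t ρ := by
    refine (IsPullback.of_right (h₁₂ := pullback.snd w p) (h₂₂ := w) (v₁₃ := p) ?_ ?_ hQ.flip).flip
    · rw [Category.assoc, pullback.lift_snd, hw]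
      exact (hp.isPullback_smul_comp h' hh').flip
    · rw [Category.assoc, pullback.lift_fst, ht]
  have hR₂ : IsPullback (snd G (G ⊗ T')) (G ◁ γ[G, T'] ≫ γ[G, T'] ≫ h) (snd G T' ≫ t) ρ := by
    rw [← ht]
    exact ((isPullback_snd_whiskerLeft G γ[G, T']).flip.paste_horiz hR.flip).flip
  let β : G ⊗ (G ⊗ T') ⟶ G ⊗ T' :=
    lift (lift (fst G (G ⊗ T')) (snd G (G ⊗ T') ≫ fst G T') ≫ μ[G]) (snd G (G ⊗ T') ≫ snd G T')
  have hβ : β ≫ γ[G, T'] = G ◁ γ[G, T'] ≫ γ[G, T'] := smul_whiskerLeft_smul T'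
  have hβj : β ≫ γ[G, T'] ≫ h = G ◁ γ[G, T'] ≫ γ[G, T'] ≫ h := by
    rw [reassoc_of% hβ]
  obtain ⟨T, π, q, hπ, hqπ, hq, H⟩ := exists_isPullback_of_descentDatum (ρ := ρ.left) (t := t.left)
    (h := h.left) (a := γ[G, T'].left) (p := (snd G T').left) (j := (γ[G, T'] ≫ h).left)
    (e := (lift (toUnit T' ≫ η[G]) (𝟙 T')).left) (p₂ := (snd G (G ⊗ T')).left)
    (j₂ := (G ◁ γ[G, T'] ≫ γ[G, T'] ≫ h).left) (α := (G ◁ γ[G, T']).left)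
    (β := β.left) (congrArg (·.left) (pullback.lift_fst t h' hw))
    (congrArg (·.left) ht) (hR.map (Over.forget B)) (hR₂.map (Over.forget B)) rfl
    (congrArg Over.Hom.left (one_smul_lift (G := G) T'))
    (congrArg Over.Hom.left (whiskerLeft_snd G γ[G, T'])) rfl
    (congrArg Over.Hom.left (lift_snd _ (snd G (G ⊗ T') ≫ snd G T')))
    (congrArg Over.Hom.left hβj) (congrArg Over.Hom.left hβ.symm)
  let π' : Over.mk (π ≫ W.hom) ⟶ W := Over.homMk π rfl
  let q' : T' ⟶ Over.mk (π ≫ W.hom) := Over.homMk q (by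
    change q ≫ π ≫ W.hom = _
    rw [reassoc_of% hqπ, Over.w])
  refine ⟨_, q', π', hπ, Over.OverMorphism.ext hqπ, hp.of_isPullback (v := π' ≫ w) hh' ?_
    (Over.OverMorphism.ext hq)⟩
  have H' : IsPullback q' h π' ρ := by
    refine IsPullback.of_map (Over.forget B) ?_ H
    rw [pullback.lift_fst]
    exact Over.OverMorphism.ext hqπ
  have := H'.flip.paste_horiz hQ.flip
  rw [pullback.lift_snd] at this
  exact this.flip
end Quotient

/-! ### Twists of torsors -/

section CartesianMonoidal

universe v w

variable {C : Type w} [Category.{v} C] [CartesianMonoidalCategory C]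

theorem isPullback_fst_whiskerRight {X Y : C} (f : X ⟶ Y) (P : C) :
    IsPullback (fst X P) (f ▷ P) f (fst Y P) := by
  refine ⟨⟨by simp⟩, ⟨PullbackCone.IsLimit.mk _ (fun s ↦ lift s.fst (s.snd ≫ snd Y P)) ?_ ?_ ?_⟩⟩
  · intro s; simp
  · intro s
    ext
    · simp [s.condition]
    · simp
  · intro s m h₁ h₂
    ext
    · simp [← h₁]
    · simp [← h₂]

/-- The action on a fibre product `Y ×_X L` induced by an action on `Y` over `X`. -/
noncomputable abbrev pullbackAction {G Y X L : C} [MonObj G] [ModObj G Y] (p : Y ⟶ X)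
    (hp : γ[G, Y] ≫ p = snd G Y ≫ p) (i : L ⟶ X) [HasPullback p i] :
    ModObj G (pullback p i) where
  smul := pullback.lift (G ◁ pullback.fst p i ≫ γ[G, Y]) (snd G _ ≫ pullback.snd p i) (by
    rw [Category.assoc, hp, whiskerLeft_snd_assoc, Category.assoc, pullback.condition])
  one_smul := by
    change η[G] ▷ pullback p i ≫ pullback.lift _ _ _ = (λ_ _).hom
    apply pullback.hom_ext
    · rw [Category.assoc, pullback.lift_fst, ← whisker_exchange_assoc, ModObj.one_smul_self,
        leftUnitor_naturality]
    · rw [Category.assoc, pullback.lift_snd, whiskerRight_snd_assoc, leftUnitor_hom]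
  mul_smul := by
    change μ[G] ▷ pullback p i ≫ pullback.lift _ _ _ =
      (α_ _ _ _).hom ≫ G ◁ pullback.lift _ _ _ ≫ pullback.lift _ _ _
    apply pullback.hom_ext
    · simp only [Category.assoc, pullback.lift_fst]
      rw [← whisker_exchange_assoc, ModObj.mul_smul_self,
        ← MonoidalCategory.whiskerLeft_comp_assoc, pullback.lift_fst]
      simp
    · simp only [Category.assoc, pullback.lift_snd, whiskerLeft_snd_assoc]
      simp

end CartesianMonoidal

section Twist

variable {B : Scheme.{u}} {G : Over B}

theorem isPullback_left {X Y Z W : Over B} {f : X ⟶ Y} {g : X ⟶ Z} {h : Y ⟶ W} {k : Z ⟶ W}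
    (H : IsPullback f g h k) : IsPullback f.left g.left h.left k.left :=
  H.map (Over.forget B)

theorem isAffineHom_snd_left (Y : Over B) [IsAffineHom G.hom] : IsAffineHom (snd G Y).left :=
  isAffineHom_of_isPullback (IsPullback.of_hasPullback G.hom Y.hom).flip

variable [GrpObj G]

theorem IsTorsor.smul_comp {Y X : Over B} [ModObj G Y] {p : Y ⟶ X} (hp : IsTorsor G p) :
    γ[G, Y] ≫ p = snd G Y ≫ p := hp.isPullback.w.symm

/-- A torsor under an affine group is affine: its base change along itself is `G × Y ⟶ Y`. -/
theorem IsTorsor.isAffineHom {Y X : Over B} [ModObj G Y] {p : Y ⟶ X} (hp : IsTorsor G p)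
    [IsAffineHom G.hom] [QuasiCompact p.left] [QuasiSeparated p.left] : IsAffineHom p.left := by
  have := hp.flat
  have := hp.surjective
  have := isAffineHom_snd_left (G := G) Y
  exact isAffineHom_of_isPullback_of_flat (isPullback_left hp.isPullback).flip

/-- The pullback of a torsor `Y ⟶ X` along `i : L ⟶ X`. -/
noncomputable def Torsor.pullback {X L : Over B} (f : Torsor G X) (i : L ⟶ X) : Torsor G L :=
  letI := pullbackAction f.proj f.isTorsor.smul_comp i
  { total := Limits.pullback f.proj i
    proj := Limits.pullback.snd f.proj i
    isTorsor := f.isTorsor.of_isPullback (pullback.lift_fst _ _ _)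
      (IsPullback.of_hasPullback f.proj i).flip (pullback.lift_snd _ _ _) }

/-- The projection from the total space of a pullback torsor to the original total space. -/
noncomputable def Torsor.pullbackFst {X L : Over B} (f : Torsor G X) (i : L ⟶ X) :
    (f.pullback i).total ⟶ f.total := Limits.pullback.fst f.proj i

theorem Torsor.smul_pullbackFst {X L : Over B} (f : Torsor G X) (i : L ⟶ X) :
    γ[G, (f.pullback i).total] ≫ f.pullbackFst i = G ◁ f.pullbackFst i ≫ γ[G, f.total] :=
  pullback.lift_fst _ _ _

theorem Torsor.pullbackFst_proj {X L : Over B} (f : Torsor G X) (i : L ⟶ X) :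
    f.pullbackFst i ≫ f.proj = (f.pullback i).proj ≫ i := pullback.condition

/-- Twists of an affine torsor by affine torsors exist. The quotient of `Y × P` is formed by descent
along `P ⟶ L`, using the equivariant projection `Y × P ⟶ P`. It is affine over `X × L`, hence
separated over `L`. -/
theorem exists_twist {X L : Over B} [IsSeparated X.hom] (f : Torsor G X) [IsAffineHom f.proj.left]
    (P : Torsor G L) [IsAffineHom P.proj.left] :
    ∃ t : Twist f L P.cls, IsSeparated t.toL.left := by
  let := diagonalAction G f.total P.total
  have h₁ : IsAffineHom (f.proj ▷ P.total).left :=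
    isAffineHom_of_isPullback (isPullback_left (isPullback_fst_whiskerRight f.proj P.total)).flip
  have h₂ : IsAffineHom (X ◁ P.proj).left :=
    isAffineHom_of_isPullback (isPullback_left (isPullback_snd_whiskerLeft X P.proj)).flip
  have h₃ : IsAffineHom (f.proj ▷ P.total ≫ X ◁ P.proj).left :=
    inferInstanceAs (IsAffineHom ((f.proj ▷ P.total).left ≫ (X ◁ P.proj).left))
  have hfst : γ[G, f.total ⊗ P.total] ≫ fst _ _ = G ◁ fst _ _ ≫ γ[G, f.total] := lift_fst _ _
  have hsnd : γ[G, f.total ⊗ P.total] ≫ snd _ _ = G ◁ snd _ _ ≫ γ[G, P.total] := lift_snd _ _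
  obtain ⟨T, q, π, hπ, hqπ, hq⟩ := P.isTorsor.exists_quotient (T' := f.total ⊗ P.total)
    (h' := snd f.total P.total) (t := f.proj ▷ P.total ≫ X ◁ P.proj) (w := snd X L)
    hsnd (by
      apply CartesianMonoidalCategory.hom_ext
      · simp only [Category.assoc, whiskerLeft_fst, whiskerRight_fst]
        rw [reassoc_of% hfst, f.isTorsor.smul_comp, whiskerLeft_snd_assoc]
      · simp only [Category.assoc, whiskerLeft_snd, whiskerRight_snd_assoc]
        rw [reassoc_of% hsnd, P.isTorsor.smul_comp, whiskerLeft_snd_assoc]) (by simp)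
  refine ⟨⟨P, rfl, T, q, hq, π ≫ fst X L, ?_, π ≫ snd X L, ?_⟩, ?_⟩
  · rw [reassoc_of% hqπ]
    simp
  · rw [reassoc_of% hqπ]
    simp
  · have : IsSeparated (snd X L).left :=
      inferInstanceAs (IsSeparated (Limits.pullback.snd X.hom L.hom))
    exact inferInstanceAs (IsSeparated (π.left ≫ (snd X L).left))

/-- Invariant morphisms on the total space of a torsor factor through the base, since fppf
coverings are effective epimorphisms. -/
theorem IsTorsor.exists_desc {P L : Over B} [ModObj G P] {p : P ⟶ L} (hp : IsTorsor G p)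
    {T : Over B} (s : P ⟶ T) (hs : γ[G, P] ≫ s = snd G P ≫ s) : ∃ σ : L ⟶ T, p ≫ σ = s := by
  have := hp.flat
  have := hp.surjective
  have := hp.locallyOfFinitePresentation
  have H : IsPullback (snd G P).left γ[G, P].left p.left p.left :=
    isPullback_left hp.isPullback
  have hd {Z : Scheme.{u}} (g₁ g₂ : Z ⟶ P.left) (hg : g₁ ≫ p.left = g₂ ≫ p.left) :
      g₁ ≫ s.left = g₂ ≫ s.left := by
    have h₁ := H.lift_fst g₁ g₂ hg
    have h₂ := H.lift_snd g₁ g₂ hg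
    have h₃ : γ[G, P].left ≫ s.left = (snd G P).left ≫ s.left := congrArg Over.Hom.left hs
    calc g₁ ≫ s.left = H.lift g₁ g₂ hg ≫ (snd G P).left ≫ s.left := by rw [reassoc_of% h₁]
      _ = g₂ ≫ s.left := by rw [← h₃, reassoc_of% h₂]
  have h : p.left ≫ EffectiveEpi.desc p.left s.left hd = s.left := EffectiveEpi.fac p.left _ _
  refine ⟨Over.homMk (EffectiveEpi.desc p.left s.left hd) ?_, Over.OverMorphism.ext h⟩
  rw [← cancel_epi p.left, reassoc_of% h, Over.w, Over.w]

theorem IsTorsor.hom_ext {P L : Over B} [ModObj G P] {p : P ⟶ L} (hp : IsTorsor G p)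
    {T : Over B} {σ τ : L ⟶ T} (h : p ≫ σ = p ≫ τ) : σ = τ := by
  have := hp.flat
  have := hp.surjective
  have := hp.locallyOfFinitePresentation
  apply Over.OverMorphism.ext
  rw [← cancel_epi p.left]
  exact congrArg Over.Hom.left h

/-- The twist of `f : Y ⟶ X` by the class of its own pullback along `i : L ⟶ X` has an `L`-point
over `i`: the invariant morphism `P ⟶ Y × P`, `y ↦ (y, y)`, induces it. -/
theorem Twist.exists_section {X L : Over B} {f : Torsor G X} {i : L ⟶ X}
    (t : Twist f L (f.pullback i).cls) :
    ∃ σ : L ⟶ t.total, σ ≫ t.toL = 𝟙 L ∧ σ ≫ t.toX = i := by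
  obtain ⟨e, he, he'⟩ := Quotient.exact t.cls_eq
  let m : t.P.total ⟶ f.total := e.hom ≫ f.pullbackFst i
  have hm : γ[G, t.P.total] ≫ m = G ◁ m ≫ γ[G, f.total] := by
    rw [MonoidalCategory.whiskerLeft_comp_assoc, ← f.smul_pullbackFst, reassoc_of% he']
  have hm' : m ≫ f.proj = t.P.proj ≫ i := by
    rw [Category.assoc, f.pullbackFst_proj, reassoc_of% he]
  let := diagonalAction G f.total t.P.total
  have hfst : γ[G, f.total ⊗ t.P.total] ≫ fst _ _ = G ◁ fst _ _ ≫ γ[G, f.total] := lift_fst _ _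
  have hsnd : γ[G, f.total ⊗ t.P.total] ≫ snd _ _ = G ◁ snd _ _ ≫ γ[G, t.P.total] := lift_snd _ _
  have hl : γ[G, t.P.total] ≫ lift m (𝟙 _) =
      G ◁ lift m (𝟙 _) ≫ γ[G, f.total ⊗ t.P.total] := by
    apply CartesianMonoidalCategory.hom_ext
    · rw [Category.assoc, Category.assoc, lift_fst, hfst, hm,
        ← MonoidalCategory.whiskerLeft_comp_assoc, lift_fst]
    · rw [Category.assoc, Category.assoc, lift_snd, hsnd,
        ← MonoidalCategory.whiskerLeft_comp_assoc, lift_snd]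
      simp
  obtain ⟨σ, hσ⟩ := t.P.isTorsor.exists_desc (lift m (𝟙 _) ≫ t.quot) (by
    rw [reassoc_of% hl, t.isTorsor.smul_comp, whiskerLeft_snd_assoc])
  refine ⟨σ, t.P.isTorsor.hom_ext ?_, t.P.isTorsor.hom_ext ?_⟩
  · rw [reassoc_of% hσ, t.quot_toL, lift_snd_assoc, Category.id_comp, Category.comp_id]
  · rw [reassoc_of% hσ, t.quot_toX, lift_fst_assoc, hm']

end Twist

end ZeroCycleDescent

/-! ### Residue degrees and zero-cycles -/

/-- The degree `[E : F]` of the field extension given by a ring homomorphism `φ : F →+* E`. As for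
`Module.finrank`, it is zero if the extension is infinite. -/
noncomputable def RingHom.extensionDegree {F E : Type*} [CommRing F] [CommRing E]
    (φ : F →+* E) : ℕ :=
  letI := φ.toAlgebra
  Module.finrank F E

theorem RingHom.extensionDegree_algebraMap (F E : Type*) [CommRing F] [CommRing E] [Algebra F E] :
    (algebraMap F E).extensionDegree = Module.finrank F E := by
  rw [extensionDegree, _root_.toAlgebra_algebraMap]

theorem RingHom.extensionDegree_comp {F E K : Type*} [Field F] [Field E] [Field K]
    (ψ : E →+* K) (φ : F →+* E) :
    (ψ.comp φ).extensionDegree = φ.extensionDegree * ψ.extensionDegree := by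
  let := φ.toAlgebra
  let := ψ.toAlgebra
  let := (ψ.comp φ).toAlgebra
  have : IsScalarTower F E K := .of_algebraMap_eq' rfl
  exact (Module.finrank_mul_finrank F E K).symm

theorem RingHom.extensionDegree_of_bijective {F E : Type*} [Field F] [Field E] (φ : F →+* E)
    (h : Function.Bijective φ) : φ.extensionDegree = 1 := by
  let := φ.toAlgebra
  exact (LinearEquiv.ofBijective (Algebra.linearMap F E) h).finrank_eq.symm.trans
    (Module.finrank_self F)

namespace AlgebraicGeometry.Scheme.Hom

variable {X Y Z : Scheme.{u}}

theorem residueDegree_eq (f : X ⟶ Y) (x : X) :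
    f.residueDegree x = (f.residueFieldMap x).hom.extensionDegree := rfl

theorem residueDegree_comp (f : X ⟶ Y) (g : Y ⟶ Z) (x : X) :
    (f ≫ g).residueDegree x = g.residueDegree (f x) * f.residueDegree x := by
  rw [residueDegree_eq, residueFieldMap_comp]
  exact RingHom.extensionDegree_comp (f.residueFieldMap x).hom (g.residueFieldMap (f x)).hom

/-- A preimmersion is surjective on stalks, hence induces isomorphisms of residue fields. -/
theorem residueDegree_of_isPreimmersion (f : X ⟶ Y) [IsPreimmersion f] (x : X) :
    f.residueDegree x = 1 := by
  refine RingHom.extensionDegree_of_bijective _ ⟨RingHom.injective _, fun y ↦ ?_⟩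
  obtain ⟨y, rfl⟩ := X.residue_surjective x y
  obtain ⟨y, rfl⟩ := f.stalkMap_surjective x y
  exact ⟨Y.residue (f x) y, congr($(residue_residueFieldMap f x) y)⟩

theorem bijective_Γevaluation_Spec (F : Type u) [Field F] (x : Spec (.of F)) :
    Function.Bijective ((Scheme.ΓSpecIso (.of F)).inv ≫ (Spec (.of F)).Γevaluation x).hom := by
  refine ⟨RingHom.injective _, ?_⟩
  let p : PrimeSpectrum F := x
  have : p.asIdeal.IsMaximal := p.asIdeal.eq_bot_of_prime ▸ Ideal.bot_isMaximal
  have h : (Scheme.ΓSpecIso (.of F)).inv ≫ (Spec (.of F)).Γevaluation x =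
      CommRingCat.ofHom (algebraMap F p.asIdeal.ResidueField) ≫
        (Spec.residueFieldIso (.of F) x).inv := (Spec.algebraMap_residueFieldIso_inv _ _).symm
  rw [h]
  exact (ConcreteCategory.bijective_of_isIso (Spec.residueFieldIso (.of F) x).inv).2.comp
    p.asIdeal.algebraMap_residueField_surjective

theorem residueDegree_SpecMap {F E : Type u} [Field F] [Field E] (φ : F →+* E)
    (x : Spec (.of E)) :
    (Spec.map (CommRingCat.ofHom φ)).residueDegree x = φ.extensionDegree := by
  let f := Spec.map (CommRingCat.ofHom φ)
  have h : ((Scheme.ΓSpecIso (.of F)).inv ≫ (Spec (.of F)).Γevaluation (f x)) ≫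
      f.residueFieldMap x = CommRingCat.ofHom φ ≫
        ((Scheme.ΓSpecIso (.of E)).inv ≫ (Spec (.of E)).Γevaluation x) := by
    rw [Category.assoc, Γevaluation_naturality, ← Scheme.ΓSpecIso_inv_naturality_assoc]
  have h' := congrArg (fun ψ ↦ ψ.hom.extensionDegree) h
  have h₁ := RingHom.extensionDegree_comp (f.residueFieldMap x).hom
    ((Scheme.ΓSpecIso (.of F)).inv ≫ (Spec (.of F)).Γevaluation (f x)).hom
  have h₂ := RingHom.extensionDegree_comp
    ((Scheme.ΓSpecIso (.of E)).inv ≫ (Spec (.of E)).Γevaluation x).hom φ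
  rw [RingHom.extensionDegree_of_bijective _ (bijective_Γevaluation_Spec F (f x)), one_mul] at h₁
  rw [RingHom.extensionDegree_of_bijective _ (bijective_Γevaluation_Spec E x), mul_one] at h₂
  exact h₁.symm.trans (h'.trans h₂)

end AlgebraicGeometry.Scheme.Hom

namespace ZeroCycleDescent

variable {V W T : Scheme.{u}}

theorem degree_single (π : V ⟶ T) (x : V) (n : ℤ) :
    degree π (Finsupp.single x n) = n * π.residueDegree x :=
  Finsupp.sum_single_index (zero_mul _)

theorem degree_sum {ι : Type*} (π : V ⟶ T) (s : Finset ι) (z : ι → V →₀ ℤ) :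
    degree π (∑ i ∈ s, z i) = ∑ i ∈ s, degree π (z i) :=
  (Finsupp.sum_finsetSum_index (fun _ ↦ zero_mul _) fun _ _ _ ↦ add_mul _ _ _).symm

theorem pushforward_single (g : V ⟶ W) (x : V) (n : ℤ) :
    pushforward g (Finsupp.single x n) = Finsupp.single (g x) (n * (g.residueDegree x : ℤ)) :=
  Finsupp.sum_single_index (by simp)

theorem pushforward_sum {ι : Type*} (g : V ⟶ W) (s : Finset ι) (z : ι → V →₀ ℤ) :
    pushforward g (∑ i ∈ s, z i) = ∑ i ∈ s, pushforward g (z i) :=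
  (Finsupp.sum_finsetSum_index (by simp) (by simp [add_mul])).symm

theorem degree_comp (g : V ⟶ W) (π : W ⟶ T) (z : V →₀ ℤ) :
    degree (g ≫ π) z = degree π (pushforward g z) := by
  rw [pushforward, Finsupp.sum, degree_sum]
  refine Finset.sum_congr rfl fun x _ ↦ ?_
  beta_reduce
  rw [degree_single, Scheme.Hom.residueDegree_comp]
  push_cast
  ring

theorem degree_comp_SpecMap {F E : Type u} [Field F] [Field E] (π : V ⟶ Spec (.of E))
    (φ : F →+* E) (z : V →₀ ℤ) :
    degree (π ≫ Spec.map (CommRingCat.ofHom φ)) z = φ.extensionDegree * degree π z := by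
  rw [degree, degree, Finsupp.mul_sum]
  refine Finset.sum_congr rfl fun x _ ↦ ?_
  beta_reduce
  rw [Scheme.Hom.residueDegree_comp, Scheme.Hom.residueDegree_SpecMap]
  push_cast
  ring

theorem support_pushforward_subset {g : V ⟶ W} (hg : closedPoints V ⊆ g ⁻¹' closedPoints W)
    {z : V →₀ ℤ} (hz : (z.support : Set V) ⊆ closedPoints V) :
    ((pushforward g z).support : Set W) ⊆ closedPoints W := by
  classical
  intro y hy
  obtain ⟨x, hx, hxy⟩ := Finset.mem_biUnion.mp (Finsupp.support_finsetSum hy)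
  obtain rfl := Finset.mem_singleton.mp (Finsupp.support_single_subset hxy)
  exact hg (hz hx)

theorem sum_mem_zeroCyclesOfDegree {ι : Type*} {π : V ⟶ T} {s : Finset ι} {z : ι → V →₀ ℤ}
    {d : ι → ℤ} (h : ∀ i ∈ s, z i ∈ zeroCyclesOfDegree π (d i)) :
    ∑ i ∈ s, z i ∈ zeroCyclesOfDegree π (∑ i ∈ s, d i) := by
  classical
  refine ⟨fun x hx ↦ ?_, ?_⟩
  · obtain ⟨i, hi, hxi⟩ := Finset.mem_biUnion.mp (Finsupp.support_finsetSum hx)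
    exact (h i hi).1 hxi
  · rw [degree_sum]
    exact Finset.sum_congr rfl fun i hi ↦ (h i hi).2

/-! ### The descent set -/

theorem IsTorsor.isAffineHom_of_isSeparated {B : Scheme.{u}} {G X Y : Over B} [GrpObj G]
    [IsAffineHom G.hom] [IsSeparated X.hom] [IsSeparated Y.hom] [QuasiCompact Y.hom]
    [ModObj G Y] {p : Y ⟶ X} (hp : IsTorsor G p) : IsAffineHom p.left := by
  have h₁ : IsSeparated (p.left ≫ X.hom) := by rw [Over.w]; infer_instance
  have h₂ : QuasiCompact (p.left ≫ X.hom) := by rw [Over.w]; infer_instance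
  have : IsSeparated p.left := .of_comp p.left X.hom
  have : QuasiCompact p.left := .of_comp p.left X.hom
  exact hp.isAffineHom

variable {k kbar : Type u} [Field k] [Field kbar] [Algebra k kbar] {X G : Over (Spec (.of k))}
  [GrpObj G]

/-- The morphism from a twist to `X` maps closed points to closed points. -/
theorem Twist.closedPoints_subset [LocallyOfFiniteType X.hom] {f : Torsor G X}
    [LocallyOfFiniteType f.total.hom] {K : FiniteSubextension k kbar} {τ : H1 (specOver K) G}
    (t : Twist f (specOver K) τ) :
    closedPoints t.total.left ⊆ t.toX.left ⁻¹' closedPoints X.left := by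
  intro y hy
  have := K.2
  have hK : IsFinite (specOver K).hom :=
    (IsFinite.SpecMap_iff _).mpr (RingHom.finite_algebraMap.mpr inferInstance)
  have hP : LocallyOfFiniteType t.P.total.hom := by
    have := t.P.isTorsor.locallyOfFinitePresentation
    rw [← Over.w t.P.proj]
    infer_instance
  have hZ : LocallyOfFiniteType (f.total ⊗ t.P.total).hom :=
    inferInstanceAs (LocallyOfFiniteType
      (Limits.pullback.fst f.total.hom t.P.total.hom ≫ f.total.hom))
  have hX : JacobsonSpace X.left := LocallyOfFiniteType.jacobsonSpace X.hom
  have hZJ : JacobsonSpace ↥(f.total ⊗ t.P.total).left :=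
    LocallyOfFiniteType.jacobsonSpace (f.total ⊗ t.P.total).hom
  have hg : LocallyOfFiniteType (t.quot ≫ t.toX).left := by
    have : LocallyOfFiniteType ((t.quot ≫ t.toX).left ≫ X.hom) := by
      rw [Over.w]
      exact hZ
    exact locallyOfFiniteType_of_comp _ X.hom
  let := diagonalAction G f.total t.P.total
  have hs : Surjective t.quot.left := t.isTorsor.surjective
  -- the twist is not known to be locally of finite type, but `Y × P` is: `z` is a closed point of
  -- `Y × P` over `y`
  obtain ⟨z, hzy, hz⟩ := nonempty_inter_closedPoints (Z := t.quot.left ⁻¹' {y})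
    (t.quot.left.surjective y) (IsClosed.preimage t.quot.left.continuous hy).isLocallyClosed
  have := (t.quot ≫ t.toX).left.closePoints_subset_preimage_closedPoints hz
  obtain rfl : t.quot.left z = y := hzy
  exact this

/-- A cycle of degree `Δ` on a twist over `K` pushes forward to a cycle of degree `[K : k] Δ`. -/
theorem Twist.pushforward_mem [LocallyOfFiniteType X.hom] {f : Torsor G X}
    [LocallyOfFiniteType f.total.hom] {K : FiniteSubextension k kbar} {τ : H1 (specOver K) G}
    (t : Twist f (specOver K) τ) {z : t.total.left →₀ ℤ} {Δ : ℤ}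
    (hz : z ∈ zeroCyclesOfDegree t.toL.left Δ) :
    pushforward t.toX.left z ∈ zeroCyclesOfDegree X.hom (Module.finrank k K.1 * Δ) := by
  refine ⟨support_pushforward_subset t.closedPoints_subset hz.1, ?_⟩
  rw [← degree_comp]
  have h₁ : t.toX.left ≫ X.hom = t.toL.left ≫ (specOver K).hom := by rw [Over.w, Over.w]
  rw [h₁, ← hz.2, ← RingHom.extensionDegree_algebraMap]
  exact degree_comp_SpecMap t.toL.left (algebraMap k K.1) z

/-- Elements of the descent set are zero-cycles of degree `d`; this is a count of degrees. -/
theorem descentSet_subset [LocallyOfFiniteType X.hom] (f : Torsor G X)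
    [LocallyOfFiniteType f.total.hom] (d : ℤ) :
    descentSet kbar f d ⊆ zeroCyclesOfDegree X.hom d := by
  rintro _ ⟨I, Yt, Δ, z, rfl, hz, rfl⟩
  simp only [Finset.mul_sum]
  exact sum_mem_zeroCyclesOfDegree fun K _ ↦ sum_mem_zeroCyclesOfDegree fun τ _ ↦
    (Yt K τ).pushforward_mem (hz K τ)

/-- A closed point `x` is the image of a morphism `Spec K ⟶ X`, where `K` is the image of an
embedding of the residue field of `x` into `kbar`. -/
theorem exists_specOver_hom [IsAlgClosed kbar] [LocallyOfFiniteType X.hom] {x : X.left}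
    (hx : x ∈ closedPoints X.left) :
    ∃ (K : FiniteSubextension k kbar) (i : specOver K ⟶ X),
      i.left (IsLocalRing.closedPoint K.1) = x ∧
      i.left.residueDegree (IsLocalRing.closedPoint K.1) = 1 ∧
      X.hom.residueDegree x = Module.finrank k K.1 := by
  have := isClosed_singleton_iff_isClosedImmersion.mp hx
  let g : Spec (X.left.residueField x) ⟶ Spec (.of k) := X.left.fromSpecResidueField x ≫ X.hom
  have hg : IsFinite g := isFinite_iff_locallyOfFiniteType_of_jacobsonSpace.mpr
    (inferInstanceAs (LocallyOfFiniteType (X.left.fromSpecResidueField x ≫ X.hom)))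
  obtain ⟨φ, hφ⟩ := Spec.map_surjective g
  rw [← hφ, IsFinite.SpecMap_iff] at hg
  let := φ.hom.toAlgebra
  have : FiniteDimensional k (X.left.residueField x) := hg
  let j : X.left.residueField x →ₐ[k] kbar := IsAlgClosed.lift
  let e : X.left.residueField x ≃ₐ[k] j.fieldRange := AlgEquiv.ofInjectiveField j
  let K : FiniteSubextension k kbar := ⟨j.fieldRange, e.toLinearEquiv.finiteDimensional⟩
  let ε : X.left.residueField x ⟶ .of K.1 := CommRingCat.ofHom e.toRingEquiv.toRingHom
  have hε : IsIso ε := e.toRingEquiv.toCommRingCatIso.isIso_hom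
  let i : specOver K ⟶ X := Over.homMk (Spec.map ε ≫ X.left.fromSpecResidueField x) (by
    change (Spec.map ε ≫ X.left.fromSpecResidueField x) ≫ X.hom = _
    rw [Category.assoc]
    change Spec.map ε ≫ g = _
    rw [← hφ, ← Spec.map_comp]
    congr 1
    ext a
    exact congrArg Subtype.val (e.commutes a))
  have hi : i.left.residueDegree (IsLocalRing.closedPoint K.1) = 1 :=
    have : IsPreimmersion i.left :=
      inferInstanceAs (IsPreimmersion (Spec.map ε ≫ X.left.fromSpecResidueField x))
    i.left.residueDegree_of_isPreimmersion _
  have hix : i.left (IsLocalRing.closedPoint K.1) = x :=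
    (X.left.range_fromSpecResidueField x).le ⟨_, rfl⟩
  refine ⟨K, i, hix, hi, ?_⟩
  have h₁ := Scheme.Hom.residueDegree_comp i.left X.hom (IsLocalRing.closedPoint K.1)
  rw [hi, mul_one, Over.w, hix] at h₁
  rw [← h₁, ← RingHom.extensionDegree_algebraMap]
  exact Scheme.Hom.residueDegree_SpecMap (algebraMap k K.1) _

/-- For every closed point `x` there is a pair `(K, τ)` such that `x` lifts to a `K`-rational point
on the twist by `τ`, with the same residue field as `x`. Here `τ` is the class of the fibre of the
torsor at `x`. -/
theorem exists_twist_point [IsAlgClosed kbar] [LocallyOfFiniteType X.hom] [IsSeparated X.hom]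
    (f : Torsor G X) [IsAffineHom f.proj.left] {x : X.left} (hx : x ∈ closedPoints X.left) :
    ∃ p : Σ K : FiniteSubextension k kbar, H1 (specOver K) G,
      X.hom.residueDegree x = Module.finrank k p.1.1 ∧
      (∃ t : Twist f (specOver p.1) p.2, IsSeparated t.toL.left) ∧
      ∀ t : Twist f (specOver p.1) p.2, IsSeparated t.toL.left →
        ∃ y ∈ closedPoints t.total.left, t.toX.left y = x ∧
          t.toX.left.residueDegree y = 1 ∧ t.toL.left.residueDegree y = 1 := by
  obtain ⟨K, i, hix, hi, hK⟩ := exists_specOver_hom (kbar := kbar) hx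
  refine ⟨⟨K, (f.pullback i).cls⟩, hK, ?_, fun t ht ↦ ?_⟩
  · have : IsAffineHom (f.pullback i).proj.left := isAffineHom_of_isPullback
      (isPullback_left (IsPullback.of_hasPullback f.proj i)).flip
    exact exists_twist f (f.pullback i)
  · obtain ⟨σ, hσL, hσX⟩ := t.exists_section
    have hσL' : σ.left ≫ t.toL.left = 𝟙 _ := congrArg (·.left) hσL
    have hσX' : σ.left ≫ t.toX.left = i.left := congrArg (·.left) hσX
    have : IsClosedImmersion (σ.left ≫ t.toL.left) := by rw [hσL']; infer_instance
    have : IsClosedImmersion σ.left := .of_comp σ.left t.toL.left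
    let p : (specOver K).left := IsLocalRing.closedPoint K.1
    have hp : IsClosed {p} := IsLocalRing.isClosed_singleton_closedPoint K.1
    have h₁ := Scheme.Hom.residueDegree_comp σ.left t.toX.left p
    have h₂ := Scheme.Hom.residueDegree_comp σ.left t.toL.left p
    rw [hσX', hi] at h₁
    rw [hσL', Scheme.Hom.residueDegree_id] at h₂
    refine ⟨σ.left p, ?_, ?_, Nat.eq_one_of_mul_eq_one_right h₁.symm,
      Nat.eq_one_of_mul_eq_one_right h₂.symm⟩
    · simpa using σ.left.isClosedEmbedding.isClosedMap _ hp
    · rw [← Scheme.Hom.comp_apply, hσX']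
      exact hix

/-- A sum over `s` can be sorted according to the values of a function `c` to a sigma type. -/
theorem sum_fiberwise_sigma {α M : Type*} {ι : Type*} {β : ι → Type*} [AddCommMonoid M]
    [DecidableEq (Σ i, β i)] (s : Finset α) (c : α → Σ i, β i) {S : Finset ι}
    {T : ∀ i : S, Finset (β i)}
    (hS : ∀ x ∈ s, (c x).1 ∈ S) (hT : ∀ x (hx : x ∈ s), (c x).2 ∈ T ⟨_, hS x hx⟩) (F : α → M) :
    ∑ i : S, ∑ b : T i, ∑ x ∈ s, (if c x = ⟨i, b⟩ then F x else 0) = ∑ x ∈ s, F x := by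
  classical
  have h (i : S) : ∑ b : T i, ∑ x ∈ s, (if c x = ⟨i, b⟩ then F x else 0) =
      ∑ x ∈ s, ∑ b : T i, (if c x = ⟨i, b⟩ then F x else 0) := Finset.sum_comm
  rw [Finset.sum_congr rfl fun i _ ↦ h i, Finset.sum_comm]
  refine Finset.sum_congr rfl fun x hx ↦ ?_
  rw [Finset.sum_eq_single ⟨_, hS x hx⟩, Finset.sum_eq_single ⟨_, hT x hx⟩]
  · simp
  · rintro ⟨b, hb⟩ - hne
    refine if_neg fun h ↦ hne (Subtype.ext ?_)
    exact (sigma_mk_injective (i := (c x).1) h).symm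
  · simp
  · rintro ⟨i, hi⟩ - hne
    refine Finset.sum_eq_zero fun b _ ↦ if_neg fun h ↦ hne ?_
    exact Subtype.ext (congrArg Sigma.fst h).symm
  · simp

/-- Each point of a zero-cycle is the pushforward of a rational point of a suitable twist. -/
theorem zeroCyclesOfDegree_subset [IsAlgClosed kbar] [LocallyOfFiniteType X.hom]
    [IsSeparated X.hom] [Nonempty X.left] (f : Torsor G X) [IsAffineHom f.proj.left] (d : ℤ) :
    zeroCyclesOfDegree X.hom d ⊆ descentSet kbar f d := by
  classical
  rintro z ⟨hz, rfl⟩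
  have hX : JacobsonSpace X.left := LocallyOfFiniteType.jacobsonSpace X.hom
  obtain ⟨x₀, -, hx₀⟩ := nonempty_inter_closedPoints (Set.univ_nonempty (α := X.left))
    isClosed_univ.isLocallyClosed
  -- `c x` is the pair `(K, τ)` attached to `x`; for each pair, one twist `t` is chosen, so that it
  -- can be shared by all closed points with that pair, which lift to it as `y`
  choose c hc hcT hcy using fun x : closedPoints X.left ↦ exists_twist_point (kbar := kbar) f x.2
  have hT (p : Set.range c) : ∃ t : Twist f (specOver p.1.1) p.1.2, IsSeparated t.toL.left := by
    obtain ⟨_, x, rfl⟩ := p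
    exact hcT x
  choose t ht using hT
  have hy (p : Set.range c) (x : closedPoints X.left) (hx : c x = p) :
      ∃ y ∈ closedPoints (t p).total.left, (t p).toX.left y = x.1 ∧
        (t p).toX.left.residueDegree y = 1 ∧ (t p).toL.left.residueDegree y = 1 := by
    obtain ⟨_, hp⟩ := p
    subst hx
    exact hcy x _ (ht _)
  choose y hyc hyx hyX hyL using hy
  -- `x₀` is added because the index sets `S` and `T_K` have to be non-empty even if `z = 0`
  let s : Finset (closedPoints X.left) :=
    insert ⟨x₀, hx₀⟩ (z.support.subtype (· ∈ closedPoints X.left))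
  have hzs : ∑ x ∈ s, Finsupp.single x.1 (z x) = z := by
    have h := Finset.sum_map s (Function.Embedding.subtype (· ∈ closedPoints X.left))
      fun x ↦ Finsupp.single x (z x)
    refine h.symm.trans (.trans ?_ z.sum_single)
    refine (Finsupp.sum_of_support_subset z (fun x hx ↦ ?_) _ (by simp)).symm
    exact Finset.mem_map.mpr ⟨⟨x, hz hx⟩,
      Finset.mem_insert_of_mem (Finset.mem_subtype.mpr hx), rfl⟩
  let I : DescentIndex kbar G :=
    { S := s.image fun x ↦ (c x).1
      S_nonempty := ⟨_, Finset.mem_image_of_mem _ (Finset.mem_insert_self _ _)⟩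
      T := fun K ↦ (s.image c).preimage (Sigma.mk (β := fun K ↦ H1 (specOver K) G) K.1)
        sigma_mk_injective.injOn
      T_nonempty := fun K ↦ by
        obtain ⟨x, hx, hxK⟩ := Finset.mem_image.mp K.2
        obtain ⟨K, hK⟩ := K
        subst hxK
        exact ⟨(c x).2, Finset.mem_preimage.mpr (Finset.mem_image_of_mem c hx)⟩ }
  have hI (K : I.S) (τ : I.T K) : (⟨K.1, τ.1⟩ : Σ K, H1 (specOver K) G) ∈ Set.range c := by
    obtain ⟨x, -, hx⟩ := Finset.mem_image.mp
      ((Finset.mem_preimage (hf := sigma_mk_injective.injOn)).mp τ.2)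
    exact ⟨x, hx⟩
  have hS (x) (hx : x ∈ s) : (c x).1 ∈ I.S := Finset.mem_image_of_mem _ hx
  have hT (x) (hx : x ∈ s) : (c x).2 ∈ I.T ⟨_, hS x hx⟩ :=
    (Finset.mem_preimage (hf := sigma_mk_injective.injOn)).mpr (Finset.mem_image_of_mem c hx)
  refine ⟨I, fun K τ ↦ t ⟨⟨K.1, τ.1⟩, hI K τ⟩,
    fun K τ ↦ ∑ x ∈ s, if c x = ⟨K.1, τ.1⟩ then z x else 0,
    fun K τ ↦ ∑ x ∈ s, if h : c x = ⟨K.1, τ.1⟩ then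
      Finsupp.single (y ⟨⟨K.1, τ.1⟩, hI K τ⟩ x h) (z x) else 0, ?_, fun K τ ↦ ?_, ?_⟩
  · have h (K : I.S) (τ : I.T K) (x) : (Module.finrank k K.1.1 : ℤ) *
        (if c x = ⟨K.1, τ.1⟩ then z x else 0) =
        if c x = ⟨K.1, τ.1⟩ then z x * (X.hom.residueDegree x.1 : ℤ) else 0 := by
      split_ifs with hx
      · rw [hc x, hx, mul_comm]
      · simp
    simp only [Finset.mul_sum, h]
    rw [sum_fiberwise_sigma s c hS hT]
    conv_rhs => rw [← hzs, degree_sum]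
    exact Finset.sum_congr rfl fun x _ ↦ (degree_single _ _ _).symm
  · refine sum_mem_zeroCyclesOfDegree fun x _ ↦ ?_
    split_ifs with h
    · refine ⟨fun w hw ↦ ?_, ?_⟩
      · obtain rfl := Finset.mem_singleton.mp (Finsupp.support_single_subset hw)
        exact hyc _ _ _
      · rw [degree_single, hyL, Nat.cast_one, mul_one]
    · exact ⟨by simp, by simp [degree]⟩
  · rw [descentPushforward]
    have h (K : I.S) (τ : I.T K) : pushforward (t ⟨⟨K.1, τ.1⟩, hI K τ⟩).toX.left
        (∑ x ∈ s, if h : c x = ⟨K.1, τ.1⟩ then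
          Finsupp.single (y ⟨⟨K.1, τ.1⟩, hI K τ⟩ x h) (z x) else 0) =
        ∑ x ∈ s, if c x = ⟨K.1, τ.1⟩ then Finsupp.single x.1 (z x) else 0 := by
      rw [pushforward_sum]
      refine Finset.sum_congr rfl fun x _ ↦ ?_
      split_ifs with h
      · rw [pushforward_single, hyx, hyX, Nat.cast_one, mul_one]
      · simp [pushforward]
    simp only [h]
    rw [sum_fiberwise_sigma s c hS hT, hzs]

end ZeroCycleDescent

theorem mainTheorem8
    (k kbar : Type u) [Field k] [NumberField k]
    [Field kbar] [Algebra k kbar] [IsAlgClosure k kbar]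
    (X : Over (Spec (.of k)))
    [Smooth X.hom] [IsProper X.hom] [GeometricallyIntegral X.hom]
    (G : Over (Spec (.of k))) [GrpObj G] [IsAffineHom G.hom] [LocallyOfFiniteType G.hom]
    (f : ZeroCycleDescent.Torsor G X)
    [IsSeparated f.total.hom] [QuasiCompact f.total.hom] [Smooth f.total.hom]
    (d : ℤ) :
    ZeroCycleDescent.descentSet kbar f d = ZeroCycleDescent.zeroCyclesOfDegree X.hom d := by
  have : IsAlgClosed kbar := IsAlgClosure.isAlgClosed k
  have : IsAffineHom f.proj.left := f.isTorsor.isAffineHom_of_isSeparated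
  have : Nonempty X.left := (X.hom.surjective (IsLocalRing.closedPoint k)).nonempty
  exact (ZeroCycleDescent.descentSet_subset f d).antisymm
    (ZeroCycleDescent.zeroCyclesOfDegree_subset f d)
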